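/- A partially ordered pattern (POP) of size $k\ge 0$ is a partial order $P$ on $\{1,\dots,k\}$. A permutation $\pi$ of size $n$ contains $P$ if there are indices $i_1<\cdots<i_k$ with $\pi(i_a)<\pi(i_b)$ whenever $a<b$ in $P$; $\operatorname{Av}(P)$ is the set of all permutations that do not contain $P$. Call $P$ bipartite if every chain of $P$ has at most two elements. The insertion encoding of a nonempty permutation is the unique word describing its construction, from a single slot $\diamond$, by successive insertion of the values $1,2,3,\dots$: the letters $l_i$, $m_i$, $r_i$, $f_i$ replace the $i$-th slot from the left by $v\,\diamond$, by $\diamond\, v\,\diamond$, by $\diamond\, v$, or by $v$, respectively, where $v$ is the next value, and at the end no slot is left. A set of permutations has a regular insertion encoding if the insertion encodings of its nonempty members form a regular language over a finite subset of the set of all letters $l_i,m_i,r_i,f_i$ ($i\ge1$). Theorem. (1) For every POP $P$, the class $\operatorname{Av}(P)$ has a regular insertion encoding if and only if $P$ is bipartite. (2) If $P$ is bipartite, then the generating function $\sum_{n\ge0}|\{\pi\in\operatorname{Av}(P):\pi\text{ has size }n\}|\,x^n$ is rational. Moreover there is an algorithm which, given any $k$ and any bipartite POP $P$ of size $k$ (as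 $k$ and a list containing exactly those pairs $(a,b)$ of labels for which $a<b$ in $P$), halts and outputs polynomials $p,q\in\mathbb{Z}[x]$ with $q(0)\neq0$ such that this generating function equals $p/q$. -/

import Mathlib

/-! ### Partially ordered patterns and the classes they define -/

/-- A partially ordered pattern (POP) of size `k`: a partial order on the labels `Fin k`
(the labels `1, …, k`, written from `0`). It is kept as a field, so that it is never confused
with the usual order of `Fin k`. -/
structure POP (k : ℕ) where
  order : PartialOrder (Fin k)

/-- The strict order relation of a POP. -/
def POP.lt {k : ℕ} (P : POP k) (a b : Fin k) : Prop := P.order.lt a b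

/-- A POP is bipartite if it has height at most two: every chain has at most two elements. -/
def POP.IsBipartite {k : ℕ} (P : POP k) : Prop :=
  ∀ s : Finset (Fin k), IsChain P.order.le (s : Set (Fin k)) → s.card ≤ 2

/-- `π` contains `P` if there are indices `i_1 < ⋯ < i_k` such that `π (i_a) < π (i_b)`
whenever `a < b` in `P`. -/
def ContainsPOP {n k : ℕ} (π : Equiv.Perm (Fin n)) (P : POP k) : Prop :=
  ∃ i : Fin k → Fin n, StrictMono i ∧ ∀ a b : Fin k, P.lt a b → π (i a) < π (i b)

/-- `Av(P)`, the set of the permutations (of all sizes, the empty one included) avoiding `P`. -/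
def Av {k : ℕ} (P : POP k) : Set (Σ n : ℕ, Equiv.Perm (Fin n)) :=
  {π | ¬ ContainsPOP π.2 P}

/-! ### The insertion encoding -/

/-- The four ways of inserting a new maximum `v` into a slot `⋄`:
`⋄ ↦ v ⋄` (left), `⋄ ↦ ⋄ v ⋄` (middle), `⋄ ↦ ⋄ v` (right), `⋄ ↦ v` (fill). -/
inductive InsertionKind where
  | left
  | middle
  | right
  | fill

/-- A letter `l_i`, `m_i`, `r_i` or `f_i`: the kind of the insertion and the index of the slot it
acts on, slots being counted from the left, from `0`. -/
structure InsertionLetter where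
  kind : InsertionKind
  slot : ℕ

/-- A configuration is a word in values (`some v`) and slots (`none`). -/
abbrev Configuration := List (Option ℕ)

/-- The word that replaces a slot when `v` is inserted into it. -/
def InsertionKind.replacement (v : ℕ) : InsertionKind → Configuration
  | .left => [some v, none]
  | .middle => [none, some v, none]
  | .right => [none, some v]
  | .fill => [some v]

/-- Replace the slot of index `j` by the word `r`; undefined if there is no such slot. -/
def replaceSlot (r : Configuration) : Configuration → ℕ → Option Configuration
  | [], _ => none
  | some a :: c, j => (replaceSlot r c j).map (some a :: ·)
  | none :: c, 0 => some (r ++ c)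
  | none :: c, j + 1 => (replaceSlot r c j).map (none :: ·)

/-- Read a word of letters, starting at the configuration `c` and inserting successively the
values `v, v + 1, v + 2, …`; undefined if a letter refers to a slot that does not exist. -/
def evolve : ℕ → Configuration → List InsertionLetter → Option Configuration
  | _, c, [] => some c
  | v, c, x :: w => (replaceSlot (x.kind.replacement v) c x.slot).bind fun c' => evolve (v + 1) c' w

/-- The word `w` encodes `π`: it transforms the single slot `⋄` into the word
`π(0) π(1) ⋯ π(n-1)`, in which no slot is left. (Values are counted from `0`. Every slot has to
receive at least one value, so the empty permutation, and only it, has no encoding.) -/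
def Encodes (w : List InsertionLetter) {n : ℕ} (π : Equiv.Perm (Fin n)) : Prop :=
  evolve 0 [none] w = some (List.ofFn fun i : Fin n => some (π i : ℕ))

/-- The insertion encoding of a set of permutations: the language of the words encoding
its members. -/
def insertionEncoding (C : Set (Σ n : ℕ, Equiv.Perm (Fin n))) : Language InsertionLetter :=
  {w | ∃ π ∈ C, Encodes w π.2}

/-- The insertion encoding of `C` is a regular language over a finite alphabet: it is accepted by
a finite automaton and uses only finitely many of the letters `l_i`, `m_i`, `r_i`, `f_i`. -/
def HasRegularInsertionEncoding (C : Set (Σ n : ℕ, Equiv.Perm (Fin n))) : Prop :=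
  (insertionEncoding C).IsRegular ∧
    ∃ A : Set InsertionLetter, A.Finite ∧ ∀ w ∈ insertionEncoding C, ∀ x ∈ w, x ∈ A

/-! ### Generating functions -/

/-- The generating function `∑ |C_n| X ^ n`, where `C_n` is the set of members of size `n`. -/
noncomputable def genFun (C : Set (Σ n : ℕ, Equiv.Perm (Fin n))) : PowerSeries ℤ :=
  PowerSeries.mk fun n => (Nat.card {π : Equiv.Perm (Fin n) // (⟨n, π⟩ : Σ m : ℕ, Equiv.Perm (Fin m)) ∈ C} : ℤ)

/-- The power series `f` is the expansion of the rational function `p / q`. -/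
def IsQuotient (f : PowerSeries ℤ) (p q : Polynomial ℤ) : Prop :=
  q.coeff 0 ≠ 0 ∧ (q : PowerSeries ℤ) * f = (p : PowerSeries ℤ)

/-- The polynomial with the given list of coefficients, constant term first. -/
noncomputable def polyOfList : List ℤ → Polynomial ℤ
  | [] => 0
  | a :: l => Polynomial.C a + Polynomial.X * polyOfList l

/-- The list `E` describes `P`: it lists the pairs `(a, b)` of labels with `a < b` in `P`. -/
def POP.IsDescribedBy {k : ℕ} (P : POP k) (E : List (ℕ × ℕ)) : Prop :=
  ∀ a b : Fin k, P.lt a b ↔ ((a : ℕ), (b : ℕ)) ∈ E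

/-! The insertion encoding is treated as a run through configurations. Replacing all entries `≥ v`
of the final word by slots recovers the configuration before the insertion of `v`
(`skeleton_evolve`); this gives existence and uniqueness of encodings, and lets slots be counted in
the finished permutation.

Let `P` be bipartite. A configuration with more than `k` slots only completes to words with a
subsequence large, small, large, small, … of length `2 * k`. Giving each label one of `k`
consecutive pairs, and its small entry exactly when the label lies below another, yields an
occurrence of `P`. So configurations completable to an avoider have at most `k` slots
(`POP.IsBipartite.count_le`). What matters for the future is then finite: the number of slots, and
the types of the partial occurrences, in which some labels wait inside slots. Values arrive in
increasing order, so a label waiting in a slot can never end up below a label already holding a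
value; every other relation between a waiting label and an inserted one holds automatically. These
data determine how they change under each letter (`partialTypes_replaceSlot`), hence the left
quotient of the language. There are finitely many quotients, and Myhill–Nerode gives regularity.

Conversely, if `a < b < c` in `P`, small and large values can be interleaved, each block monotone in
a direction that excludes one of the two relations. These avoiders need arbitrarily many slots, and
the shortest words in the quotients have unbounded length, so the language is not regular.

Rationality follows from Cayley–Hamilton for the transfer operator of the minimal automaton. The
number of states also bounds the degrees of `p` and `q` explicitly in `k`. With degrees at most `N`,
agreement of `q * f` and `p` in degrees up to `2 * N` forces equality, so an unbounded search with a
primitive recursive test, based on brute-force counting of avoiders, finds a correct pair. -/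

/-! ### Slots and skeletons of configurations -/

/-- A configuration is well formed before the insertion of `v` if its values are smaller than `v`
and no two of its slots are adjacent. -/
def WellFormed (v : ℕ) (c : Configuration) : Prop :=
  (∀ a, some a ∈ c → a < v) ∧ c.IsChain fun x y => x ≠ none ∨ y ≠ none

/-- Put a slot in front of a configuration, merging it with an initial slot. -/
def consSlot : Configuration → Configuration
  | none :: c => none :: c
  | c => none :: c

/-- Replace the maximal runs of slots and values `≥ v` by single slots. -/
def skeleton (v : ℕ) : Configuration → Configuration
  | [] => []
  | some a :: c => if a < v then some a :: skeleton v c else consSlot (skeleton v c)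
  | none :: c => consSlot (skeleton v c)

@[simp] theorem consSlot_nil : consSlot [] = [none] := rfl
@[simp] theorem consSlot_none (c : Configuration) : consSlot (none :: c) = none :: c := rfl
@[simp] theorem consSlot_some (a : ℕ) (c : Configuration) :
    consSlot (some a :: c) = none :: some a :: c := rfl
@[simp] theorem consSlot_consSlot (c : Configuration) : consSlot (consSlot c) = consSlot c := by
  rcases c with _ | ⟨_ | a, c⟩ <;> rfl

/-! ### Single insertions and how to undo them. -/

theorem replaceSlot_eq_some_iff {r c c' : Configuration} {j : ℕ} :
    replaceSlot r c j = some c' ↔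
      ∃ c₁ c₂, c = c₁ ++ none :: c₂ ∧ c₁.count none = j ∧ c' = c₁ ++ (r ++ c₂) := by
  induction c generalizing j c' with
  | nil => simp [replaceSlot]
  | cons x c ih =>
    constructor
    · intro h
      match x, j, h with
      | some a, j, h =>
        simp only [replaceSlot, Option.map_eq_some_iff] at h
        obtain ⟨e, he, rfl⟩ := h
        obtain ⟨c₁, c₂, rfl, rfl, rfl⟩ := ih.1 he
        exact ⟨some a :: c₁, c₂, by simp⟩
      | none, 0, h =>
        simp only [replaceSlot, Option.some.injEq] at h
        exact ⟨[], c, by simp [h]⟩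
      | none, j + 1, h =>
        simp only [replaceSlot, Option.map_eq_some_iff] at h
        obtain ⟨e, he, rfl⟩ := h
        obtain ⟨c₁, c₂, rfl, rfl, rfl⟩ := ih.1 he
        exact ⟨none :: c₁, c₂, by simp⟩
    · rintro ⟨c₁, c₂, h, rfl, rfl⟩
      rcases c₁ with _ | ⟨_ | a, c₁⟩
      · simp only [List.nil_append, List.cons.injEq] at h
        obtain ⟨rfl, rfl⟩ := h
        simp [replaceSlot]
      · simp only [List.cons_append, List.cons.injEq] at h
        obtain ⟨rfl, rfl⟩ := h
        have := ih.2 ⟨c₁, c₂, rfl, rfl, rfl⟩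
        simp [replaceSlot, this]
      · simp only [List.cons_append, List.cons.injEq] at h
        obtain ⟨rfl, rfl⟩ := h
        have := ih.2 ⟨c₁, c₂, rfl, rfl, rfl⟩
        simp [replaceSlot, this]

theorem exists_replaceSlot_iff {r c : Configuration} {j : ℕ} :
    (∃ c', replaceSlot r c j = some c') ↔ j < c.count none := by
  induction c generalizing j with
  | nil => simp [replaceSlot]
  | cons x c ih =>
    match x, j with
    | some a, j => simpa [replaceSlot] using ih
    | none, 0 => simp [replaceSlot]
    | none, j + 1 => simpa [replaceSlot] using ih

theorem wellFormed_cons_some {v a : ℕ} {c : Configuration} :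
    WellFormed v (some a :: c) ↔ a < v ∧ WellFormed v c := by
  simp only [WellFormed, List.mem_cons, List.isChain_cons]
  aesop

theorem wellFormed_cons_none {v : ℕ} {c : Configuration} :
    WellFormed v (none :: c) ↔ WellFormed v c ∧ c.head? ≠ some none := by
  simp only [WellFormed, List.mem_cons, List.isChain_cons]
  aesop

theorem WellFormed.mono {v v' : ℕ} {c : Configuration} (h : WellFormed v c) (hv : v ≤ v') :
    WellFormed v' c :=
  ⟨fun a ha => (h.1 a ha).trans_le hv, h.2⟩

theorem WellFormed.replaceSlot {v : ℕ} {t : InsertionKind} {c c' : Configuration} {j : ℕ}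
    (h : WellFormed v c) (hc : replaceSlot (t.replacement v) c j = some c') :
    WellFormed (v + 1) c' ∧ (c.head? ≠ some none → c'.head? ≠ some none) := by
  induction c generalizing j c' with
  | nil => simp [_root_.replaceSlot] at hc
  | cons x c ih =>
    match x, j, hc with
    | some a, j, hc =>
      simp only [_root_.replaceSlot, Option.map_eq_some_iff] at hc
      obtain ⟨e, he, rfl⟩ := hc
      rw [wellFormed_cons_some] at h ⊢
      exact ⟨⟨by omega, (ih h.2 he).1⟩, by simp⟩
    | none, 0, hc =>
      simp only [_root_.replaceSlot, Option.some.injEq] at hc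
      subst hc
      rw [wellFormed_cons_none] at h
      have := h.1.mono (Nat.le_succ v)
      cases t <;>
        simp [InsertionKind.replacement, wellFormed_cons_some, wellFormed_cons_none, h.2, this]
    | none, j + 1, hc =>
      simp only [_root_.replaceSlot, Option.map_eq_some_iff] at hc
      obtain ⟨e, he, rfl⟩ := hc
      rw [wellFormed_cons_none] at h ⊢
      exact ⟨⟨(ih h.1 he).1, (ih h.1 he).2 h.2⟩, by simp⟩

theorem consSlot_eq_cons {c : Configuration} (h : c.head? ≠ some none) :
    consSlot c = none :: c := by
  rcases c with _ | ⟨_ | a, c⟩ <;> simp_all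

theorem skeleton_of_wellFormed {v : ℕ} {c : Configuration} (h : WellFormed v c) :
    skeleton v c = c := by
  induction c with
  | nil => rfl
  | cons x c ih =>
    cases x with
    | some a =>
      rw [wellFormed_cons_some] at h
      simp [skeleton, h.1, ih h.2]
    | none =>
      rw [wellFormed_cons_none] at h
      simp [skeleton, ih h.1, consSlot_eq_cons h.2]

theorem skeleton_consSlot (v : ℕ) (c : Configuration) :
    skeleton v (consSlot c) = consSlot (skeleton v c) := by
  rcases c with _ | ⟨_ | a, c⟩ <;> simp [skeleton]

theorem skeleton_skeleton {v v' : ℕ} (hv : v ≤ v') (c : Configuration) :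
    skeleton v (skeleton v' c) = skeleton v c := by
  induction c with
  | nil => rfl
  | cons x c ih =>
    cases x with
    | some a =>
      by_cases h : a < v'
      · simp [skeleton, h, ih]
      · have h' : ¬ a < v := by omega
        simp [skeleton, h, h', ih, skeleton_consSlot]
    | none => simp [skeleton, ih, skeleton_consSlot]

/-- Erasing the new value merges the replacement back into one slot; as no two slots of `c` are
adjacent, nothing else merges with it. -/
theorem skeleton_replaceSlot {v : ℕ} {t : InsertionKind} {c c' : Configuration} {j : ℕ}
    (h : WellFormed v c) (hc : replaceSlot (t.replacement v) c j = some c') :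
    skeleton v c' = c := by
  induction c generalizing j c' with
  | nil => simp [replaceSlot] at hc
  | cons x c ih =>
    match x, j, hc with
    | some a, j, hc =>
      simp only [replaceSlot, Option.map_eq_some_iff] at hc
      obtain ⟨e, he, rfl⟩ := hc
      rw [wellFormed_cons_some] at h
      simp [skeleton, h.1, ih h.2 he]
    | none, 0, hc =>
      simp only [replaceSlot, Option.some.injEq] at hc
      subst hc
      rw [wellFormed_cons_none] at h
      cases t <;>
        simp [InsertionKind.replacement, skeleton, skeleton_of_wellFormed h.1,
          consSlot_eq_cons h.2]
    | none, j + 1, hc =>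
      simp only [replaceSlot, Option.map_eq_some_iff] at hc
      obtain ⟨e, he, rfl⟩ := hc
      rw [wellFormed_cons_none] at h
      simp [skeleton, ih h.1 he, consSlot_eq_cons h.2]

theorem replaceSlot_injective {v : ℕ} {t t' : InsertionKind} {c c' : Configuration} {j j' : ℕ}
    (h : WellFormed v c) (hc : replaceSlot (t.replacement v) c j = some c')
    (hc' : replaceSlot (t'.replacement v) c j' = some c') : t = t' ∧ j = j' := by
  induction c generalizing j j' c' with
  | nil => simp [replaceSlot] at hc
  | cons x c ih =>
    cases x with
    | some a =>
      simp only [replaceSlot, Option.map_eq_some_iff] at hc hc'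
      obtain ⟨e, he, rfl⟩ := hc
      obtain ⟨e', he', h'⟩ := hc'
      rw [wellFormed_cons_some] at h
      obtain rfl : e' = e := by simpa using h'
      exact ih h.2 he he'
    | none =>
      rw [wellFormed_cons_none] at h
      obtain ⟨hw, hh⟩ := h
      -- Insertions into the first slot and into a later one differ: in the latter case the first
      -- slot survives and is followed by an old value `a < v`, never by `v`.
      have key : ∀ (t t' : InsertionKind) (j : ℕ) (e : Configuration),
          replaceSlot (t.replacement v) c j = some e → t'.replacement v ++ c ≠ none :: e := by
        intro t t' j e he heq
        rcases c with _ | ⟨_ | a, c⟩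
        · simp [replaceSlot] at he
        · simp at hh
        · have := hw.1 a (by simp)
          simp only [replaceSlot, Option.map_eq_some_iff] at he
          obtain ⟨e, he, rfl⟩ := he
          cases t' <;> simp [InsertionKind.replacement] at heq <;> omega
      match j, j' with
      | 0, 0 =>
        simp only [replaceSlot, Option.some.injEq] at hc hc'
        have := hc.trans hc'.symm
        cases t <;> cases t' <;> simp [InsertionKind.replacement] at this ⊢
      | 0, j' + 1 =>
        simp only [replaceSlot, Option.some.injEq, Option.map_eq_some_iff] at hc hc'
        obtain ⟨e, he, rfl⟩ := hc'
        exact (key _ _ _ _ he hc).elim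
      | j + 1, 0 =>
        simp only [replaceSlot, Option.some.injEq, Option.map_eq_some_iff] at hc hc'
        obtain ⟨e, he, rfl⟩ := hc
        exact (key _ _ _ _ he hc').elim
      | j + 1, j' + 1 =>
        simp only [replaceSlot, Option.map_eq_some_iff] at hc hc'
        obtain ⟨e, he, rfl⟩ := hc
        obtain ⟨e', he', h'⟩ := hc'
        obtain rfl : e' = e := by simpa using h'
        simpa using ih hw he he'

/-! ### Runs of insertions and their determinism. -/

theorem evolve_cons_eq_some {v : ℕ} {c d : Configuration} {x : InsertionLetter}
    {w : List InsertionLetter} :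
    evolve v c (x :: w) = some d ↔
      ∃ c', replaceSlot (x.kind.replacement v) c x.slot = some c' ∧ evolve (v + 1) c' w = some d := by
  simp [evolve, Option.bind_eq_some_iff]

theorem evolve_append (v : ℕ) (c : Configuration) (u w : List InsertionLetter) :
    evolve v c (u ++ w) = (evolve v c u).bind fun c' => evolve (v + u.length) c' w := by
  induction u generalizing v c with
  | nil => simp [evolve]
  | cons x u ih =>
    simp only [List.cons_append, evolve, ih, Option.bind_assoc, List.length_cons]
    simp only [add_assoc, add_comm 1]

theorem WellFormed.evolve {v : ℕ} {c d : Configuration} {w : List InsertionLetter}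
    (h : WellFormed v c) (hd : evolve v c w = some d) : WellFormed (v + w.length) d := by
  induction w generalizing v c with
  | nil => simp_all [_root_.evolve]
  | cons x w ih =>
    obtain ⟨c', h₁, h₂⟩ := evolve_cons_eq_some.1 hd
    have := ih (h.replaceSlot h₁).1 h₂
    rwa [List.length_cons, ← add_assoc, add_right_comm]

/-- Every configuration on the way to `d` is thus determined by `d` and the number of values
inserted so far. -/
theorem skeleton_evolve {v : ℕ} {c d : Configuration} {w : List InsertionLetter}
    (h : WellFormed v c) (hd : evolve v c w = some d) : skeleton v d = c := by
  induction w generalizing v c with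
  | nil => simp_all [evolve, skeleton_of_wellFormed]
  | cons x w ih =>
    obtain ⟨c', h₁, h₂⟩ := evolve_cons_eq_some.1 hd
    rw [← skeleton_skeleton (Nat.le_succ v) d, ih (h.replaceSlot h₁).1 h₂,
      skeleton_replaceSlot h h₁]

theorem evolve_injective {v : ℕ} {c d : Configuration} {w w' : List InsertionLetter}
    (h : WellFormed v c) (hl : w.length = w'.length) (hw : evolve v c w = some d)
    (hw' : evolve v c w' = some d) : w = w' := by
  induction w generalizing v c w' with
  | nil => exact (List.length_eq_zero_iff.1 hl.symm).symm
  | cons x w ih =>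
    rcases w' with _ | ⟨x', w'⟩
    · simp at hl
    obtain ⟨c₁, h₁, h₂⟩ := evolve_cons_eq_some.1 hw
    obtain ⟨c₂, h₁', h₂'⟩ := evolve_cons_eq_some.1 hw'
    obtain rfl : c₁ = c₂ := by
      rw [← skeleton_evolve (h.replaceSlot h₁).1 h₂, ← skeleton_evolve (h.replaceSlot h₁').1 h₂']
    obtain ⟨ht, hj⟩ := replaceSlot_injective h h₁ h₁'
    rw [ih (h.replaceSlot h₁).1 (by simpa using hl) h₂ h₂']
    obtain ⟨t, j⟩ := x
    obtain ⟨t', j'⟩ := x'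
    simp_all

theorem wellFormed_slot (v : ℕ) : WellFormed v [none] := by
  simp [WellFormed]

/-! ### Existence of encodings -/

theorem skeleton_succ_of_notMem {v : ℕ} {c : Configuration} (h : some v ∉ c) :
    skeleton (v + 1) c = skeleton v c := by
  induction c with
  | nil => rfl
  | cons x c ih =>
    simp only [List.mem_cons, not_or] at h
    cases x with
    | some a =>
      have : a < v + 1 ↔ a < v := by
        have : v ≠ a := by simpa using h.1
        omega
      simp [skeleton, ih h.2, this]
    | none => simp [skeleton, ih h.2]

/-- In passing from `v` to `v + 1` only the slot hiding `v` changes; the kind of the insertion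
records on which sides of `v` this slot hides larger values. -/
theorem exists_replaceSlot_skeleton {v : ℕ} {c : Configuration} (hn : none ∉ c) (hd : c.Nodup)
    (hv : some v ∈ c) : ∃ x : InsertionLetter,
      replaceSlot (x.kind.replacement v) (skeleton v c) x.slot = some (skeleton (v + 1) c) := by
  induction c with
  | nil => simp at hv
  | cons y c ih =>
    rw [List.nodup_cons] at hd
    simp only [List.mem_cons, not_or] at hn
    rcases y with _ | a
    · simp at hn
    rcases lt_trichotomy a v with h | rfl | h
    · obtain ⟨x, hx⟩ := ih hn.2 hd.2 (by simpa [h.ne'] using hv)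
      exact ⟨x, by simp [skeleton, h, h.trans (Nat.lt_succ_self v), replaceSlot, hx]⟩
    · have h1 := skeleton_succ_of_notMem hd.1
      simp only [skeleton, lt_irrefl, if_false, Nat.lt_succ_self, if_true, h1]
      rcases hs : skeleton a c with _ | ⟨_ | b, s⟩
      · exact ⟨⟨.fill, 0⟩, by simp [replaceSlot, InsertionKind.replacement]⟩
      · exact ⟨⟨.left, 0⟩, by simp [replaceSlot, InsertionKind.replacement]⟩
      · exact ⟨⟨.fill, 0⟩, by simp [replaceSlot, InsertionKind.replacement]⟩
    · have hv' : some v ∈ c := by simpa [h.ne] using hv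
      have h2 : ¬ a < v + 1 := by omega
      simp only [skeleton, h.not_gt, h2, if_false]
      obtain ⟨x, hx⟩ := ih hn.2 hd.2 hv'
      -- The slot of `a > v` may merge with the first slot of the tail, and the next entry decides:
      -- a smaller one separates them and shifts the index by one, `v` itself gives `middle` or
      -- `right`, a larger one changes nothing.
      rcases c with _ | ⟨_ | b, c⟩
      · simp at hv'
      · simp at hn
      rcases lt_trichotomy b v with hb | rfl | hb
      · have hb' : b < v + 1 := by omega
        simp only [skeleton, hb, hb', if_true, consSlot_some] at hx ⊢
        exact ⟨⟨x.kind, x.slot + 1⟩, by simpa [replaceSlot] using hx⟩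
      · have h1 := skeleton_succ_of_notMem (List.nodup_cons.1 hd.2).1
        simp only [skeleton, lt_irrefl, if_false, Nat.lt_succ_self, if_true, h1, consSlot_consSlot,
          consSlot_some]
        rcases hs : skeleton b c with _ | ⟨_ | e, s⟩
        · exact ⟨⟨.right, 0⟩, by simp [replaceSlot, InsertionKind.replacement]⟩
        · exact ⟨⟨.middle, 0⟩, by simp [replaceSlot, InsertionKind.replacement]⟩
        · exact ⟨⟨.right, 0⟩, by simp [replaceSlot, InsertionKind.replacement]⟩
      · have hb' : ¬ b < v + 1 := by omega
        simp only [skeleton, hb.not_gt, hb', if_false, consSlot_consSlot] at hx ⊢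
        exact ⟨x, hx⟩

theorem exists_evolve_skeleton {n m v : ℕ} {c : Configuration} (hn : none ∉ c) (hd : c.Nodup)
    (hv : ∀ a, some a ∈ c ↔ a < n) (hm : v + m = n) :
    ∃ w, w.length = m ∧ evolve v (skeleton v c) w = some c := by
  induction m generalizing v with
  | zero =>
    have : WellFormed v c := by
      refine ⟨fun a ha => by have := (hv a).1 ha; omega, ?_⟩
      refine List.isChain_iff_getElem.2 fun i hi => Or.inl fun h => hn ?_
      rw [← h]
      exact List.getElem_mem _
    exact ⟨[], rfl, by simp [evolve, skeleton_of_wellFormed this]⟩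
  | succ m ih =>
    obtain ⟨w, hw, hw'⟩ := ih (v := v + 1) (by omega)
    obtain ⟨x, hx⟩ := exists_replaceSlot_skeleton hn hd ((hv v).2 (by omega))
    exact ⟨x :: w, by simp [hw], evolve_cons_eq_some.2 ⟨_, hx, hw'⟩⟩

theorem skeleton_zero {c : Configuration} (hc : c ≠ []) : skeleton 0 c = [none] := by
  induction c with
  | nil => simp at hc
  | cons x c ih =>
    rcases eq_or_ne c [] with rfl | h
    · cases x <;> simp [skeleton]
    · cases x <;> simp [skeleton, ih h]

/-! ### Values of configurations -/

theorem reduceOption_replaceSlot {v : ℕ} {t : InsertionKind} {c c' : Configuration} {j : ℕ}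
    (hc : replaceSlot (t.replacement v) c j = some c') :
    c'.reduceOption.Perm (v :: c.reduceOption) := by
  obtain ⟨c₁, c₂, rfl, -, rfl⟩ := replaceSlot_eq_some_iff.1 hc
  have : (t.replacement v).reduceOption = [v] := by
    cases t <;> rfl
  simp only [List.reduceOption_append, this, List.reduceOption_cons_of_none]
  simp

theorem reduceOption_evolve {v : ℕ} {c d : Configuration} {w : List InsertionLetter}
    (hd : evolve v c w = some d) :
    d.reduceOption.Perm (c.reduceOption ++ List.range' v w.length) := by
  induction w generalizing v c with
  | nil => simp_all [evolve]
  | cons x w ih =>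
    obtain ⟨c', h₁, h₂⟩ := evolve_cons_eq_some.1 hd
    refine (ih h₂).trans (((reduceOption_replaceSlot h₁).append_right _).trans ?_)
    simpa [List.range'_succ] using List.perm_middle.symm

theorem exists_perm_of_evolve {d : Configuration} {w : List InsertionLetter}
    (hd : evolve 0 [none] w = some d) (hn : none ∉ d) :
    ∃ π : Equiv.Perm (Fin w.length), d = List.ofFn fun i => some (π i : ℕ) := by
  have hp := reduceOption_evolve hd
  have hl : d = d.reduceOption.map some := by
    clear hp hd
    induction d with
    | nil => rfl
    | cons x d ih =>
      rcases x with _ | a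
      · simp at hn
      · simp only [List.reduceOption_cons_of_some, List.map_cons, List.cons.injEq, true_and]
        exact ih fun h => hn (List.mem_cons_of_mem _ h)
  generalize d.reduceOption = l at hp hl
  have hp' : l.Perm (List.range w.length) := by simpa [List.range_eq_range'] using hp
  have hlen : l.length = w.length := by simpa using hp'.length_eq
  have hlt : ∀ i : Fin w.length, l[i] < w.length := fun i => by
    simpa using hp'.mem_iff.1 (List.getElem_mem (l := l) (n := i) (by omega))
  have hinj : Function.Injective fun i : Fin w.length => (⟨l[i], hlt i⟩ : Fin w.length) := by
    intro i i' h
    have hnd : l.Nodup := hp'.nodup_iff.2 List.nodup_range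
    have := (hnd.getElem_inj_iff).1 (Fin.mk.inj h)
    exact Fin.ext this
  refine ⟨Equiv.ofBijective _ (Finite.injective_iff_bijective.1 hinj), ?_⟩
  rw [hl]
  apply List.ext_getElem
  · simp [hlen]
  · intro i h₁ h₂
    simp

theorem Encodes.length_eq {n : ℕ} {π : Equiv.Perm (Fin n)} {w : List InsertionLetter}
    (h : Encodes w π) : w.length = n := by
  have h2 := (reduceOption_evolve h).length_eq
  have h3 : ∀ l : List ℕ, (l.map some).reduceOption = l := fun l => by
    induction l <;> simp_all [List.reduceOption_cons_of_some]
  have h4 : (List.ofFn fun i : Fin n => some (π i : ℕ)) =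
      (List.ofFn fun i : Fin n => (π i : ℕ)).map some := by
    simp [List.map_ofFn, Function.comp_def]
  rw [h4, h3] at h2
  simpa using h2.symm

theorem exists_encodes {n : ℕ} (hn : 0 < n) (π : Equiv.Perm (Fin n)) :
    ∃ w : List InsertionLetter, Encodes w π := by
  have hne : (List.ofFn fun i : Fin n => some (π i : ℕ)) ≠ [] := by
    simp; omega
  obtain ⟨w, -, hw⟩ := exists_evolve_skeleton (n := n) (m := n) (v := 0)
    (c := List.ofFn fun i : Fin n => some (π i : ℕ)) (by simp [List.mem_ofFn])
    (List.nodup_ofFn.2 fun i i' h => π.injective (Fin.ext (by simpa using h)))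
    (fun a => by
      simp only [List.mem_ofFn, Option.some.injEq]
      exact ⟨fun ⟨i, hi⟩ => hi ▸ (π i).2, fun h => ⟨π.symm ⟨a, h⟩, by simp⟩⟩) (by simp)
  rw [skeleton_zero hne] at hw
  exact ⟨w, hw⟩

theorem Encodes.unique {n : ℕ} {π : Equiv.Perm (Fin n)} {w w' : List InsertionLetter}
    (h : Encodes w π) (h' : Encodes w' π) : w = w' :=
  evolve_injective (wellFormed_slot 0) (h.length_eq.trans h'.length_eq.symm) h h'

theorem Encodes.perm_unique {n : ℕ} {π π' : Equiv.Perm (Fin n)} {w : List InsertionLetter}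
    (h : Encodes w π) (h' : Encodes w π') : π = π' := by
  have := List.ofFn_injective (Option.some.inj (h.symm.trans h'))
  ext i
  simpa using congrFun this i

/-! ### Partial occurrences of a POP in a configuration -/

/-- The tag of a position: twice the number of slots before it, plus one if it holds a slot. -/
def tag (c : Configuration) (i : ℕ) : ℕ :=
  2 * (c.take i).count none + if (c)[i]? = some none then 1 else 0

/-- An occurrence of `P` in a configuration, some of whose entries are still to be inserted into
slots. -/
structure IsPartialOcc {k : ℕ} (P : POP k) (c : Configuration) (g : Fin k → ℕ) : Prop where
  lt_length : ∀ a, g a < c.length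
  mono : ∀ a b, a < b → g a < g b ∨ g a = g b ∧ (c)[g a]? = some none
  below : ∀ a b, P.lt a b → (c)[g b]? = some none ∨
    ∃ u w, u < w ∧ (c)[g a]? = some (some u) ∧ (c)[g b]? = some (some w)

/-- The tags of the partial occurrences of `P` in a configuration. -/
def partialTypes {k : ℕ} (P : POP k) (c : Configuration) : Set (Fin k → ℕ) :=
  {τ | ∃ g, IsPartialOcc P c g ∧ ∀ a, τ a = tag c (g a)}

theorem tag_append_left {c d : Configuration} {i : ℕ} (h : i < c.length) :
    tag (c ++ d) i = tag c i := by
  simp [tag, List.take_append_of_le_length h.le, List.getElem?_append_left h]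

theorem tag_append_right (c d : Configuration) (i : ℕ) :
    tag (c ++ d) (c.length + i) = 2 * c.count none + tag d i := by
  simp [tag, List.take_length_add_append, List.getElem?_append_right, mul_add, add_assoc]

theorem tag_le {c : Configuration} {i : ℕ} (h : i < c.length) : tag c i ≤ 2 * c.count none := by
  have h1 : c.count none = (c.take i).count none + (c.drop i).count none := by
    rw [← List.count_append, List.take_append_drop]
  rw [tag, h1, List.drop_eq_getElem_cons h, List.getElem?_eq_getElem h, List.count_cons]
  by_cases hc : (c)[i] = none <;> simp [hc]

theorem odd_tag {c : Configuration} {i : ℕ} : tag c i % 2 = 1 ↔ (c)[i]? = some none := by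
  unfold tag
  split <;> simp_all

theorem tag_replacement (t : InsertionKind) (v v' i : ℕ) :
    tag (t.replacement v) i = tag (t.replacement v') i := by
  rcases i with _ | _ | _ | i <;> cases t <;> simp [tag, InsertionKind.replacement]

theorem length_replacement (t : InsertionKind) (v v' : ℕ) :
    (t.replacement v).length = (t.replacement v').length := by
  cases t <;> rfl

theorem count_replacement (t : InsertionKind) (v v' : ℕ) :
    (t.replacement v).count none = (t.replacement v').count none := by
  cases t <;> rfl

theorem getElem?_replacement {t : InsertionKind} {v i : ℕ} (h : i < (t.replacement v).length) :
    (t.replacement v)[i]? = some none ∨ (t.replacement v)[i]? = some (some v) := by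
  rcases i with _ | _ | _ | i <;> cases t <;> simp [InsertionKind.replacement] at h ⊢
  omega

section Replace

variable (c₁ c₂ r : Configuration)

theorem getElem?_slot : (c₁ ++ none :: c₂)[c₁.length]? = some none := by simp

theorem tag_slot : tag (c₁ ++ none :: c₂) c₁.length = 2 * c₁.count none + 1 := by
  simp [tag]

theorem replace_left {i : ℕ} (h : i < c₁.length) :
    (c₁ ++ (r ++ c₂))[i]? = (c₁ ++ none :: c₂)[i]? ∧
      tag (c₁ ++ (r ++ c₂)) i = tag (c₁ ++ none :: c₂) i ∧
      tag (c₁ ++ none :: c₂) i ≤ 2 * c₁.count none := by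
  rw [List.getElem?_append_left h, List.getElem?_append_left h, tag_append_left h,
    tag_append_left h]
  exact ⟨rfl, rfl, tag_le h⟩

theorem replace_mid {i : ℕ} (h : i < r.length) :
    (c₁ ++ (r ++ c₂))[c₁.length + i]? = r[i]? ∧
      tag (c₁ ++ (r ++ c₂)) (c₁.length + i) = 2 * c₁.count none + tag r i := by
  rw [tag_append_right, tag_append_left h, List.getElem?_append_right (by omega),
    Nat.add_sub_cancel_left, List.getElem?_append_left h]
  exact ⟨rfl, rfl⟩

theorem replace_right (i : ℕ) :
    (c₁ ++ (r ++ c₂))[c₁.length + (r.length + i)]? = (c₁ ++ none :: c₂)[c₁.length + (1 + i)]? ∧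
      tag (c₁ ++ (r ++ c₂)) (c₁.length + (r.length + i)) =
        2 * c₁.count none + (2 * r.count none + tag c₂ i) ∧
      tag (c₁ ++ none :: c₂) (c₁.length + (1 + i)) = 2 * c₁.count none + (2 + tag c₂ i) := by
  have h := tag_append_right [none] c₂ i
  simp only [List.singleton_append, List.length_singleton] at h
  rw [tag_append_right, tag_append_right, tag_append_right, h,
    List.getElem?_append_right (by omega), List.getElem?_append_right (by omega),
    List.getElem?_append_right (by omega), Nat.add_sub_cancel_left, Nat.add_sub_cancel_left,
    Nat.add_sub_cancel_left, add_comm 1 i, List.getElem?_cons_succ]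
  simp

end Replace

/-- The position in `c₁ ++ none :: c₂` from which a position of `c₁ ++ (r ++ c₂)` stems, where `n`
and `m` are the lengths of `c₁` and `r`. -/
def collapsePos (n m i : ℕ) : ℕ :=
  if i < n then i else if i < n + m then n else i + 1 - m

theorem IsPartialOcc.collapse {k : ℕ} {P : POP k} {c₁ c₂ : Configuration} {t : InsertionKind}
    {v : ℕ} (hv : ∀ a, some a ∈ c₁ ++ none :: c₂ → a < v) {g : Fin k → ℕ}
    (hg : IsPartialOcc P (c₁ ++ (t.replacement v ++ c₂)) g) :
    IsPartialOcc P (c₁ ++ none :: c₂)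
      (fun a => collapsePos c₁.length (t.replacement v).length (g a)) := by
  set r := t.replacement v with hr
  set c := c₁ ++ none :: c₂ with hc
  set c' := c₁ ++ (r ++ c₂) with hc'
  set n := c₁.length with hn
  set m := r.length with hm
  have hlen : c'.length = n + m + c₂.length := by simp [hc']; omega
  have hlen' : c.length = n + 1 + c₂.length := by simp [hc]; omega
  have hout : ∀ i, (c)[collapsePos n m i]? = c'[i]? ∨ (n ≤ i ∧ i < n + m) := by
    intro i
    by_cases h1 : i < n
    · rw [collapsePos, if_pos h1]
      exact Or.inl (replace_left c₁ c₂ r h1).1.symm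
    by_cases h2 : i < n + m
    · exact Or.inr ⟨by omega, h2⟩
    · rw [collapsePos, if_neg h1, if_neg h2]
      obtain ⟨e, rfl⟩ := Nat.exists_eq_add_of_le (not_lt.1 h2)
      have := (replace_right c₁ c₂ r e).1
      rw [← hn, ← hm, ← hc, ← hc', ← add_assoc] at this
      rw [this]
      left
      congr 1
      omega
  have hin : ∀ i, n ≤ i → i < n + m → (c)[collapsePos n m i]? = some none := by
    intro i h1 h2
    rw [collapsePos, if_neg (by omega), if_pos h2]
    exact getElem?_slot c₁ c₂
  refine ⟨fun a => ?_, fun a b hab => ?_, fun a b hab => ?_⟩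
  · have := hg.lt_length a
    unfold collapsePos
    split_ifs <;> omega
  · rcases hg.mono a b hab with h | ⟨h, h'⟩
    · by_cases h3 : n ≤ g a ∧ g b < n + m
      · right
        refine ⟨?_, hin _ (by omega) (by omega)⟩
        simp only [collapsePos]
        split_ifs <;> omega
      · left
        simp only [collapsePos]
        split_ifs <;> omega
    · right
      refine ⟨by rw [h], ?_⟩
      rcases hout (g a) with h1 | h1
      · rw [h1, h']
      · exact hin _ h1.1 h1.2
  · rcases hout (g b) with hb | hb
    · rw [hb]
      rcases hg.below a b hab with h | ⟨u, w, huw, hu, hw⟩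
      · exact Or.inl h
      · refine Or.inr ⟨u, w, huw, ?_, hw⟩
        rcases hout (g a) with ha | ha
        · rw [ha, hu]
        -- Here `g a` would hold the newest value `v`, which cannot lie below the old value `w < v`.
        · exfalso
          have hwv := hv w (List.mem_of_getElem? (hb.trans hw))
          obtain ⟨e, he⟩ := Nat.exists_eq_add_of_le ha.1
          have hem : e < m := by omega
          rw [he, (replace_mid c₁ c₂ r hem).1] at hu
          rcases getElem?_replacement hem with h | h <;> rw [← hr, hu] at h <;> simp at h
          omega
    · exact Or.inl (hin _ hb.1 hb.2)

/-- A partial occurrence after the insertion is collapsed to one before it, transferred to the other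
configuration by equality of types, and expanded again. Tags make this possible: they tell positions
left of the slot, in it and right of it apart, and their parity detects slots. -/
theorem partialTypes_subset_of_eq {k : ℕ} {P : POP k} {c₁ c₂ d₁ d₂ : Configuration}
    {t : InsertionKind} {v v' : ℕ} (hv : ∀ a, some a ∈ c₁ ++ none :: c₂ → a < v)
    (hv' : ∀ a, some a ∈ d₁ ++ none :: d₂ → a < v') (hj : c₁.count none = d₁.count none)
    (h : partialTypes P (c₁ ++ none :: c₂) ⊆ partialTypes P (d₁ ++ none :: d₂)) :
    partialTypes P (c₁ ++ (t.replacement v ++ c₂)) ⊆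
      partialTypes P (d₁ ++ (t.replacement v' ++ d₂)) := by
  rintro τ ⟨g', hg', hτ⟩
  have hg := hg'.collapse hv
  obtain ⟨f, hf, hfg⟩ := h ⟨_, hg, fun a => rfl⟩
  have hlen := length_replacement t v v'
  have hcount := count_replacement t v v'
  have htag := tag_replacement t v v'
  have hrep := fun i => @getElem?_replacement t v i
  have hrep' := fun i => @getElem?_replacement t v' i
  generalize t.replacement v = r at *
  generalize t.replacement v' = s at *
  set m := s.length with hm
  set n := c₁.length with hn
  set n' := d₁.length with hn'
  have hfl : ∀ a, f a < n' + 1 + d₂.length := fun a => by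
    have := hf.lt_length a
    simp at this; omega
  have hgl : ∀ a, g' a < n + m + c₂.length := fun a => by
    have := hg'.lt_length a
    simp at this; omega
  rw [hlen] at hg
  simp only [hlen] at hfg
  -- the three zones correspond to each other
  have zone : ∀ a, (g' a < n ∧ f a < n' ∧ tag (c₁ ++ (r ++ c₂)) (g' a) =
        tag (d₁ ++ (s ++ d₂)) (f a)) ∨
      (∃ e, e < m ∧ g' a = n + e ∧ f a = n') ∨
      (∃ e, n + m ≤ g' a ∧ f a = n' + (1 + e) ∧ tag (c₁ ++ (r ++ c₂)) (g' a) =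
        tag (d₁ ++ (s ++ d₂)) (n' + (m + e))) := by
    intro a
    have h1 : tag (c₁ ++ none :: c₂) (collapsePos n m (g' a)) = tag (d₁ ++ none :: d₂) (f a) := hfg a
    have hd : (f a < n' ∧ tag (d₁ ++ none :: d₂) (f a) ≤ 2 * d₁.count none) ∨
        (f a = n' ∧ tag (d₁ ++ none :: d₂) (f a) = 2 * d₁.count none + 1) ∨
        ∃ e, f a = n' + (1 + e) ∧
          tag (d₁ ++ none :: d₂) (f a) = 2 * d₁.count none + (2 + tag d₂ e) := by
      rcases lt_trichotomy (f a) n' with h | h | h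
      · exact Or.inl ⟨h, (replace_left d₁ d₂ s h).2.2⟩
      · exact Or.inr (Or.inl ⟨h, by rw [h]; exact tag_slot d₁ d₂⟩)
      · obtain ⟨e, he⟩ := Nat.exists_eq_add_of_le (Nat.succ_le_of_lt h)
        have he' : f a = n' + (1 + e) := by omega
        refine Or.inr (Or.inr ⟨e, he', ?_⟩)
        rw [he']
        exact (replace_right d₁ d₂ s e).2.2
    by_cases ha : g' a < n
    · left
      obtain ⟨-, h3, h4⟩ := replace_left c₁ c₂ r ha
      rw [collapsePos, if_pos ha] at h1
      have hfa : f a < n' := by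
        rcases hd with ⟨h5, -⟩ | ⟨-, h5⟩ | ⟨e, -, h5⟩ <;> omega
      exact ⟨ha, hfa, by rw [h3, (replace_left d₁ d₂ s hfa).2.1, h1]⟩
    by_cases hb : g' a < n + m
    · right; left
      rw [collapsePos, if_neg ha, if_pos hb, tag_slot] at h1
      refine ⟨g' a - n, by omega, by omega, ?_⟩
      rcases hd with ⟨-, h5⟩ | ⟨h5, -⟩ | ⟨e, -, h5⟩ <;> omega
    · right; right
      obtain ⟨e, he⟩ := Nat.exists_eq_add_of_le (not_lt.1 hb)
      obtain ⟨-, h3, h4⟩ := replace_right c₁ c₂ r e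
      have hpos : collapsePos n m (g' a) = n + (1 + e) := by
        rw [collapsePos, if_neg ha, if_neg hb]; omega
      rw [hpos, h4] at h1
      rcases hd with ⟨-, h5⟩ | ⟨-, h5⟩ | ⟨e', h6, h5⟩
      · omega
      · omega
      · refine ⟨e', by omega, h6, ?_⟩
        rw [he, (replace_right d₁ d₂ s e').2.1, add_assoc, ← hlen, h3]
        omega
  have content : ∀ a i, (f a < n' ∧ i = f a ∨ ∃ e, f a = n' + (1 + e) ∧ i = n' + (m + e)) →
      (d₁ ++ (s ++ d₂))[i]? = (d₁ ++ none :: d₂)[f a]? := by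
    rintro a i (⟨h1, rfl⟩ | ⟨e, h1, rfl⟩)
    · exact (replace_left d₁ d₂ s h1).1
    · rw [h1]
      exact (replace_right d₁ d₂ s e).1
  -- Labels in the replaced slot keep their offset from `g'` inside the replacement; labels to its
  -- right move by `m - 1`.
  let p : Fin k → ℕ := fun a =>
    if f a < n' then f a else if f a = n' then n' + (g' a - n) else f a + m - 1
  have hp : ∀ a, (f a ≠ n' ∧ (d₁ ++ (s ++ d₂))[p a]? = (d₁ ++ none :: d₂)[f a]? ∧
      ¬ (n ≤ g' a ∧ g' a < n + m)) ∨
      (∃ e, e < m ∧ g' a = n + e ∧ f a = n' ∧ p a = n' + e) := by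
    intro a
    rcases zone a with ⟨h1, h2, -⟩ | ⟨e, h1, h2, h3⟩ | ⟨e, h1, h2, -⟩
    · refine Or.inl ⟨by omega, content a _ (Or.inl ⟨h2, ?_⟩), by omega⟩
      simp only [p]; rw [if_pos h2]
    · refine Or.inr ⟨e, h1, h2, h3, ?_⟩
      simp only [p]; rw [if_neg (by omega), if_pos h3]; omega
    · refine Or.inl ⟨by omega, content a _ (Or.inr ⟨e, h2, ?_⟩), by omega⟩
      simp only [p]; rw [if_neg (by omega), if_neg (by omega)]; omega
  refine ⟨p, ⟨fun a => ?_, fun a b hab => ?_, fun a b hab => ?_⟩, fun a => ?_⟩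
  · have := hfl a
    simp only [p, List.length_append]
    rcases zone a with ⟨h1, h2, -⟩ | ⟨e, h1, h2, h3⟩ | ⟨e, h1, h2, -⟩ <;> split_ifs <;> omega
  · rcases hp a with ⟨ha, ha', -⟩ | ⟨e, he, hge, hfe, hpe⟩
    · rcases hf.mono a b hab with h | ⟨h, h'⟩
      · left; simp only [p]; split_ifs <;> omega
      · right
        refine ⟨?_, ha'.trans h'⟩
        simp only [p]; split_ifs <;> omega
    · rcases hp b with ⟨hb, hb', -⟩ | ⟨e', he', hge', hfe', hpe'⟩
      · have := hf.mono a b hab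
        left; simp only [p]; split_ifs <;> omega
      · rcases hg'.mono a b hab with h | ⟨h, h'⟩
        · left; omega
        · right
          refine ⟨by omega, ?_⟩
          rw [hge, (replace_mid c₁ c₂ r (hlen ▸ he)).1] at h'
          rw [hpe, (replace_mid d₁ d₂ s he).1, ← odd_tag, ← htag, odd_tag, h']
  · rcases hp b with ⟨hb, hb', -⟩ | ⟨e, he, hge, hfe, hpe⟩
    · rw [hb']
      rcases hf.below a b hab with h | ⟨u, w, huw, hu, hw⟩
      · exact Or.inl h
      · refine Or.inr ⟨u, w, huw, ?_, hw⟩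
        rcases hp a with ⟨ha, ha', -⟩ | ⟨e, he, hge, hfe, hpe⟩
        · rw [ha', hu]
        · rw [hfe, getElem?_slot] at hu
          simp at hu
    · have he' : e < r.length := hlen ▸ he
      rw [hpe, (replace_mid d₁ d₂ s he).1]
      rcases hg'.below a b hab with h | ⟨u, w, huw, hu, hw⟩
      · left
        rw [hge, (replace_mid c₁ c₂ r he').1] at h
        rw [← odd_tag, ← htag, odd_tag, h]
      · right
        rw [hge, (replace_mid c₁ c₂ r he').1] at hw
        have hwv : w = v := by
          rcases hrep e he' with h | h <;> rw [hw] at h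
          · simp at h
          · simpa using h
        have hs : s[e]? = some (some v') := by
          refine (hrep' e he).resolve_left fun h => ?_
          rw [← odd_tag, ← htag, odd_tag, hw] at h
          simp at h
        -- Now `b` holds the new value. The label `a` holds an old value on the first side, so by
        -- parity of tags also on the second, where old values are below `v'`. It cannot be in the
        -- replacement, whose only value is the new one.
        rcases hp a with ⟨ha, ha', hz⟩ | ⟨e', he'', hge', hfe', hpe'⟩
        · have hnone : ¬ (d₁ ++ none :: d₂)[f a]? = some none := by
            rw [← odd_tag, ← hfg a, odd_tag]
            intro hcon
            have hcon2 : tag (c₁ ++ (r ++ c₂)) (g' a) % 2 ≠ 1 := by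
              rw [Ne, odd_tag, hu]; simp
            rw [← odd_tag] at hcon
            by_cases h1 : g' a < n
            · rw [collapsePos, if_pos h1, ← (replace_left c₁ c₂ r h1).2.1] at hcon
              exact hcon2 hcon
            · have h2 : ¬ g' a < n + m := by omega
              obtain ⟨e', h3⟩ := Nat.exists_eq_add_of_le (not_lt.1 h2)
              have hpos : collapsePos n m (g' a) = n + (1 + e') := by
                rw [collapsePos, if_neg h1, if_neg h2]; omega
              rw [hpos, (replace_right c₁ c₂ r e').2.2] at hcon
              rw [h3, add_assoc, ← hlen, (replace_right c₁ c₂ r e').2.1] at hcon2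
              omega
          have hlt := hf.lt_length a
          rw [List.getElem?_eq_getElem hlt] at ha' hnone
          obtain ⟨u', hu'⟩ := Option.ne_none_iff_exists'.1 fun h => hnone (congrArg some h)
          have := hv' u' (hu' ▸ List.getElem_mem hlt)
          exact ⟨u', v', this, by rw [ha', hu'], hs⟩
        · exfalso
          rw [hge', (replace_mid c₁ c₂ r (hlen ▸ he'')).1] at hu
          have huv : u = v := by
            rcases hrep e' (hlen ▸ he'') with h | h <;> rw [hu] at h
            · simp at h
            · simpa using h
          omega
  · rw [hτ a]
    rcases zone a with ⟨h1, h2, h3⟩ | ⟨e, h1, h2, h3⟩ | ⟨e, h1, h2, h3⟩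
    · have : p a = f a := by simp only [p]; rw [if_pos h2]
      rw [this, h3]
    · have : p a = n' + e := by
        simp only [p]; rw [if_neg (by omega), if_pos h3]; omega
      rw [this, h2, (replace_mid c₁ c₂ r (hlen ▸ h1)).2, (replace_mid d₁ d₂ s h1).2, htag, hj]
    · have : p a = n' + (m + e) := by
        simp only [p]; rw [if_neg (by omega), if_neg (by omega)]; omega
      rw [this, h3]

/-! ### Completions depend only on slots and partial types. -/

theorem count_replaceSlot {r c c' : Configuration} {j : ℕ} (h : replaceSlot r c j = some c') :
    c'.count none + 1 = c.count none + r.count none := by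
  obtain ⟨c₁, c₂, rfl, -, rfl⟩ := replaceSlot_eq_some_iff.1 h
  simp only [List.count_append, List.count_cons_self]
  omega

theorem partialTypes_replaceSlot {k : ℕ} {P : POP k} {c d c' d' : Configuration}
    {t : InsertionKind} {v v' j : ℕ} (hv : ∀ a, some a ∈ c → a < v)
    (hv' : ∀ a, some a ∈ d → a < v') (h : partialTypes P c = partialTypes P d)
    (hc : replaceSlot (t.replacement v) c j = some c')
    (hd : replaceSlot (t.replacement v') d j = some d') :
    partialTypes P c' = partialTypes P d' := by
  obtain ⟨c₁, c₂, rfl, h₁, rfl⟩ := replaceSlot_eq_some_iff.1 hc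
  obtain ⟨d₁, d₂, rfl, h₂, rfl⟩ := replaceSlot_eq_some_iff.1 hd
  exact (partialTypes_subset_of_eq hv hv' (h₁.trans h₂.symm) h.le).antisymm
    (partialTypes_subset_of_eq hv' hv (h₂.trans h₁.symm) h.ge)

/-- The word `w`, read from `c`, leads to a configuration without slots that avoids `P`. -/
def Completes {k : ℕ} (P : POP k) (v : ℕ) (c : Configuration) (w : List InsertionLetter) : Prop :=
  ∃ d, evolve v c w = some d ∧ none ∉ d ∧ partialTypes P d = ∅

/-- The number of slots decides which letters apply. Both invariants stay equal along the run, and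
together they decide success at its end. -/
theorem Completes.congr {k : ℕ} {P : POP k} {c d : Configuration} {v v' : ℕ}
    {w : List InsertionLetter} (hv : WellFormed v c) (hv' : WellFormed v' d)
    (hn : c.count none = d.count none) (h : partialTypes P c = partialTypes P d)
    (hc : Completes P v c w) : Completes P v' d w := by
  induction w generalizing v v' c d with
  | nil =>
    obtain ⟨e, he, h1, h2⟩ := hc
    obtain rfl : c = e := by simpa [evolve] using he
    exact ⟨d, rfl, by rwa [← List.count_eq_zero, ← hn, List.count_eq_zero], h ▸ h2⟩
  | cons x w ih =>
    obtain ⟨e, he, h1⟩ := hc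
    obtain ⟨c', h₂, h₃⟩ := evolve_cons_eq_some.1 he
    have hlt := exists_replaceSlot_iff.1 ⟨c', h₂⟩
    rw [hn] at hlt
    obtain ⟨d', hd'⟩ := exists_replaceSlot_iff (r := x.kind.replacement v').2 hlt
    have hcount := count_replaceSlot h₂
    have hcount' := count_replaceSlot hd'
    have hr := count_replacement x.kind v v'
    obtain ⟨e', he', h4⟩ := ih (hv.replaceSlot h₂).1 (hv'.replaceSlot hd').1 (by omega)
      (partialTypes_replaceSlot hv.1 hv'.1 h h₂ hd') ⟨e, h₃, h1⟩
    exact ⟨e', evolve_cons_eq_some.2 ⟨d', hd', he'⟩, h4⟩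

/-- Without slots, no label is waiting, so partial occurrences are genuine ones. -/
theorem containsPOP_iff {n k : ℕ} {π : Equiv.Perm (Fin n)} {P : POP k} :
    ContainsPOP π P ↔ (partialTypes P (List.ofFn fun i => some (π i : ℕ))).Nonempty := by
  constructor
  · rintro ⟨i, hi, hlt⟩
    refine ⟨_, fun a => i a, ⟨fun a => by simp, fun a b hab => Or.inl (hi hab), fun a b hab => ?_⟩,
      fun a => rfl⟩
    exact Or.inr ⟨π (i a), π (i b), hlt a b hab, by simp, by simp⟩
  · rintro ⟨τ, g, hg, -⟩
    have hl : ∀ a, g a < n := fun a => by simpa using hg.lt_length a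
    have hget : ∀ a, (List.ofFn fun i => some (π i : ℕ))[g a]? = some (some (π ⟨g a, hl a⟩ : ℕ)) :=
      fun a => by simp [hl a]
    refine ⟨fun a => ⟨g a, hl a⟩, fun a b hab => ?_, fun a b hab => ?_⟩
    · have := hg.mono a b hab
      rw [hget] at this
      simpa using this
    · have := hg.below a b hab
      rw [hget, hget] at this
      simpa using this

theorem mem_insertionEncoding_iff {k : ℕ} {P : POP k} {w : List InsertionLetter} :
    w ∈ insertionEncoding (Av P) ↔ Completes P 0 [none] w := by
  constructor
  · rintro ⟨π, hπ, hw⟩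
    refine ⟨_, hw, by simp [List.mem_ofFn], ?_⟩
    rw [← Set.not_nonempty_iff_eq_empty, ← containsPOP_iff]
    exact hπ
  · rintro ⟨d, hd, hn, h⟩
    obtain ⟨π, rfl⟩ := exists_perm_of_evolve hd hn
    refine ⟨⟨_, π⟩, ?_, hd⟩
    rw [← Set.not_nonempty_iff_eq_empty, ← containsPOP_iff] at h
    exact h

theorem completes_append_iff {k : ℕ} {P : POP k} {v : ℕ} {c : Configuration}
    {u w : List InsertionLetter} :
    Completes P v c (u ++ w) ↔ ∃ c', evolve v c u = some c' ∧ Completes P (v + u.length) c' w := by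
  simp only [Completes, evolve_append, Option.bind_eq_some_iff]
  constructor
  · rintro ⟨d, ⟨c', h1, h2⟩, h3⟩
    exact ⟨c', h1, d, h2, h3⟩
  · rintro ⟨c', h1, d, h2, h3⟩
    exact ⟨d, ⟨c', h1, h2⟩, h3⟩

/-! ### Bipartite POPs -/

theorem isBipartite_iff {k : ℕ} {P : POP k} :
    P.IsBipartite ↔ ∀ a b c, P.lt a b → ¬ P.lt b c := by
  -- Proved for an arbitrary order, because the instance found on `Fin k` would be the usual one.
  have key : ∀ {α : Type} [PartialOrder α] [DecidableEq α],
      (∀ s : Finset α, IsChain (· ≤ ·) (s : Set α) → s.card ≤ 2) ↔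
        ∀ a b c : α, a < b → ¬ b < c := by
    intro α _ _
    constructor
    · intro h a b c hab hbc
      have hac := hab.trans hbc
      have := h {a, b, c} (by
        simp only [Finset.coe_insert, Finset.coe_singleton]
        refine ((Set.subsingleton_singleton.isChain).insert ?_).insert ?_
        · simp [hbc.le]
        · simp [hab.le, hac.le])
      rw [Finset.card_eq_three.2 ⟨a, b, c, hab.ne, hac.ne, hbc.ne, rfl⟩] at this
      omega
    · intro h s hs
      by_contra! hcard
      obtain ⟨a, b, c, ha, hb, hc, hab, hac, hbc⟩ := Finset.two_lt_card_iff.1 hcard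
      have lt_or : ∀ x y, x ∈ s → y ∈ s → x ≠ y → x < y ∨ y < x := fun x y hx hy hxy =>
        (hs hx hy hxy).imp (lt_of_le_of_ne · hxy) (lt_of_le_of_ne · hxy.symm)
      rcases lt_or a b ha hb hab with h1 | h1 <;> rcases lt_or b c hb hc hbc with h2 | h2 <;>
        rcases lt_or a c ha hc hac with h3 | h3 <;>
        first
          | exact h _ _ _ h1 h2 | exact h _ _ _ h2 h1 | exact h _ _ _ h1 h3
          | exact h _ _ _ h3 h1 | exact h _ _ _ h2 h3 | exact h _ _ _ h3 h2
  exact @key (Fin k) P.order _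

/-- Each slot of the skeleton hides a value `≥ v`, and consecutive slots are separated by a value `<
v`; `k + 1` slots give `k` pairs (large, small). -/
theorem exists_alternating_sublist {v : ℕ} {k : ℕ} {d : Configuration} (hn : none ∉ d)
    (h : k < (skeleton v d).count none) : ∃ e : Configuration, e.Sublist d ∧ e.length = 2 * k ∧
      ∀ i < 2 * k, ∃ a, e[i]? = some (some a) ∧ (a < v ↔ i % 2 = 1) := by
  induction hl : d.length using Nat.strong_induction_on generalizing k d with
  | _ l ih =>
  subst hl
  rcases d with _ | ⟨_ | a, d⟩
  · simp [skeleton] at h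
  · simp at hn
  have hn' : none ∉ d := fun h => hn (List.mem_cons_of_mem _ h)
  by_cases ha : a < v
  · simp only [skeleton, ha, if_true, ne_eq, reduceCtorEq, not_false_eq_true,
      List.count_cons_of_ne] at h
    obtain ⟨e, he, h1⟩ := ih _ (by simp) hn' h rfl
    exact ⟨e, he.cons _, h1⟩
  simp only [skeleton, ha, if_false] at h
  rcases d with _ | ⟨_ | b, d⟩
  · have : k = 0 := by simpa [skeleton] using h
    subst this
    exact ⟨[], by simp⟩
  · simp at hn'
  by_cases hb : b < v
  · simp only [skeleton, hb, if_true, consSlot_some, List.count_cons_self, ne_eq,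
      reduceCtorEq, not_false_eq_true, List.count_cons_of_ne] at h
    rcases k with _ | k
    · exact ⟨[], by simp⟩
    obtain ⟨e, he, hl, h1⟩ := ih d.length (by simp) (k := k) (d := d)
      (fun h => hn' (List.mem_cons_of_mem _ h)) (by omega) rfl
    refine ⟨some a :: some b :: e, (he.cons_cons _).cons_cons _, by simp [hl]; omega, ?_⟩
    intro i hi
    match i with
    | 0 => exact ⟨a, by simp, by simp [ha]⟩
    | 1 => exact ⟨b, by simp, by simp [hb]⟩
    | i + 2 => simpa using h1 i (by omega)
  · have h2 : k < (skeleton v (some b :: d)).count none := by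
      simpa [skeleton, hb] using h
    obtain ⟨e, he, h1⟩ := ih _ (by simp) hn' h2 rfl
    exact ⟨e, he.cons _, h1⟩

theorem POP.IsBipartite.count_le {k : ℕ} {P : POP k} (hP : P.IsBipartite) {v : ℕ}
    {c : Configuration} {w : List InsertionLetter} (hc : WellFormed v c)
    (h : Completes P v c w) : c.count none ≤ k := by
  obtain ⟨d, hd, hn, hd'⟩ := h
  by_contra! hlt
  rw [← skeleton_evolve hc hd] at hlt
  obtain ⟨e, he, hl, h1⟩ := exists_alternating_sublist hn hlt
  obtain ⟨f, hf⟩ := List.sublist_iff_exists_orderEmbedding_getElem?_eq.1 he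
  classical
  -- Label `a` uses the pair at indices `2 * a` and `2 * a + 1`; the odd index is the small value,
  -- taken when `a` lies below some label.
  let p : Fin k → ℕ := fun a => 2 * a + if ∃ b, P.lt a b then 1 else 0
  have hp : ∀ a, p a < 2 * k := fun a => by
    have := a.2
    simp only [p]; split_ifs <;> omega
  have hmono : ∀ a b, a < b → p a < p b := fun a b hab => by
    have : (a : ℕ) < b := hab
    simp only [p]; split_ifs <;> omega
  have hpar : ∀ a, p a % 2 = 1 ↔ ∃ b, P.lt a b := fun a => by
    simp only [p]; split_ifs with h <;> simp [h]
  have hlen : ∀ a, f (p a) < d.length := fun a => by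
    obtain ⟨x, hx, -⟩ := h1 _ (hp a)
    rw [hf] at hx
    exact (List.getElem?_eq_some_iff.1 hx).1
  refine (Set.eq_empty_iff_forall_notMem.1 hd') _
    ⟨fun a => f (p a), ⟨hlen, fun a b hab => ?_, fun a b hab => ?_⟩, fun a => rfl⟩
  · exact Or.inl (f.lt_iff_lt.2 (hmono a b hab))
  · obtain ⟨x, hx, hx'⟩ := h1 _ (hp a)
    obtain ⟨y, hy, hy'⟩ := h1 _ (hp b)
    have ha := hx'.2 ((hpar a).2 ⟨b, hab⟩)
    have hb : ¬ y < v := fun hcon => by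
      obtain ⟨z, hz⟩ := (hpar b).1 (hy'.1 hcon)
      exact isBipartite_iff.1 hP a b z hab hz
    rw [hf] at hx hy
    exact Or.inr ⟨x, y, by omega, hx, hy⟩

/-! ### Regularity -/

/-- The data of a configuration that determines its completions avoiding `P`. -/
noncomputable def configState {k : ℕ} (P : POP k) (c : Configuration) :
    Fin (k + 1) × Set (Fin k → Fin (2 * k + 2)) :=
  (Fin.ofNat (k + 1) (c.count none), {τ | (fun a => (τ a : ℕ)) ∈ partialTypes P c})

theorem partialTypes_eq_of_configState {k : ℕ} {P : POP k} {c d : Configuration}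
    (hc : c.count none ≤ k) (hd : d.count none ≤ k) (h : configState P c = configState P d) :
    c.count none = d.count none ∧ partialTypes P c = partialTypes P d := by
  have key : ∀ {c d : Configuration}, c.count none ≤ k →
      configState P c = configState P d → partialTypes P c ⊆ partialTypes P d := by
    intro c d hc h τ hτ
    obtain ⟨g, hg, hgτ⟩ := id hτ
    have hlt : ∀ a, τ a < 2 * k + 2 := fun a => by
      have := tag_le (hg.lt_length a)
      rw [hgτ]; omega
    have h2 := congrArg Prod.snd h
    exact (Set.ext_iff.1 h2 fun a => ⟨τ a, hlt a⟩).1 hτ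
  refine ⟨?_, (key hc h).antisymm (key hd h.symm)⟩
  have h1 := congrArg (fun x => (x.1 : ℕ)) h
  simpa [configState, Fin.ofNat, Nat.mod_eq_of_lt (Nat.lt_succ_of_le hc),
    Nat.mod_eq_of_lt (Nat.lt_succ_of_le hd)] using h1

open Classical in
/-- The state reached by a word: that of its configuration, or `none` if there is no completion. -/
noncomputable def wordState {k : ℕ} (P : POP k) (u : List InsertionLetter) :
    Option (Fin (k + 1) × Set (Fin k → Fin (2 * k + 2))) :=
  (evolve 0 [none] u).bind fun c => if c.count none ≤ k then some (configState P c) else none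

/-- By the slot bound, a word with a completion has a state other than `none`, and `Completes.congr`
applies. If both states are `none`, both quotients are empty. -/
theorem POP.IsBipartite.leftQuotient_congr {k : ℕ} {P : POP k} (hP : P.IsBipartite)
    {u u' : List InsertionLetter} (h : wordState P u = wordState P u') :
    (insertionEncoding (Av P)).leftQuotient u = (insertionEncoding (Av P)).leftQuotient u' := by
  have key : ∀ {u u' : List InsertionLetter}, wordState P u = wordState P u' →
      ∀ w, Completes P 0 [none] (u ++ w) → Completes P 0 [none] (u' ++ w) := by
    intro u u' h w hw
    rw [completes_append_iff] at hw ⊢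
    obtain ⟨c, hc, hw⟩ := hw
    have hwf := (wellFormed_slot 0).evolve hc
    have hck := hP.count_le hwf hw
    simp only [wordState, hc, Option.bind_some, hck, if_true] at h
    rcases hd : evolve 0 [none] u' with _ | d
    · simp [hd] at h
    · have hwf' := (wellFormed_slot 0).evolve hd
      simp only [hd, Option.bind_some] at h
      split_ifs at h with hdk
      obtain ⟨h1, h2⟩ := partialTypes_eq_of_configState hck hdk (Option.some.inj h)
      exact ⟨d, rfl, hw.congr hwf hwf' h1 h2⟩
  ext w
  rw [Language.mem_leftQuotient, Language.mem_leftQuotient, mem_insertionEncoding_iff,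
    mem_insertionEncoding_iff]
  exact ⟨key h w, key h.symm w⟩

/-- A bound for the number of states of an automaton accepting the insertion encoding of `Av P`
for a bipartite POP `P` of size `k`. -/
def stateBound (k : ℕ) : ℕ := (k + 1) * 2 ^ (2 * k + 2) ^ k + 1

/-- Quotients factor through `wordState`, whose codomain has `stateBound k` elements. The explicit
bound is what later makes the search decidable at each step. -/
theorem POP.IsBipartite.range_leftQuotient {k : ℕ} {P : POP k} (hP : P.IsBipartite) :
    (Set.range (insertionEncoding (Av P)).leftQuotient).Finite ∧
      (Set.range (insertionEncoding (Av P)).leftQuotient).ncard ≤ stateBound k := by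
  classical
  have hfac : Function.FactorsThrough (insertionEncoding (Av P)).leftQuotient (wordState P) :=
    fun u u' h => hP.leftQuotient_congr h
  have hsub : Set.range (insertionEncoding (Av P)).leftQuotient ⊆
      Set.range (Function.extend (wordState P) (insertionEncoding (Av P)).leftQuotient
        fun _ => ⊥) := by
    rintro _ ⟨u, rfl⟩
    exact ⟨wordState P u, hfac.extend_apply _ u⟩
  refine ⟨(Set.finite_range _).subset hsub, (Set.ncard_le_ncard hsub (Set.finite_range _)).trans ?_⟩
  rw [← Set.image_univ]
  refine (Set.ncard_image_le).trans ?_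
  rw [Set.ncard_univ, Nat.card_eq_fintype_card]
  simp [stateBound]

theorem POP.IsBipartite.slot_le {k : ℕ} {P : POP k} (hP : P.IsBipartite)
    {w : List InsertionLetter} (hw : w ∈ insertionEncoding (Av P)) {x : InsertionLetter}
    (hx : x ∈ w) : x.slot ≤ k := by
  obtain ⟨u, z, rfl⟩ := List.append_of_mem hx
  rw [mem_insertionEncoding_iff, completes_append_iff] at hw
  obtain ⟨c, hc, hz⟩ := hw
  have hck := hP.count_le ((wellFormed_slot 0).evolve hc) hz
  obtain ⟨d, hd, -⟩ := hz
  obtain ⟨c', hc', -⟩ := evolve_cons_eq_some.1 hd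
  exact (exists_replaceSlot_iff.1 ⟨c', hc'⟩).le.trans hck

theorem finite_setOf_slot_le (k : ℕ) : {x : InsertionLetter | x.slot ≤ k}.Finite := by
  have : {x : InsertionLetter | x.slot ≤ k} ⊆
      ⋃ t ∈ ({.left, .middle, .right, .fill} : Set InsertionKind),
        (fun j => InsertionLetter.mk t j) '' Set.Iic k := by
    rintro ⟨t, j⟩ h
    cases t <;> simpa using h
  exact (Set.Finite.biUnion (by simp) fun _ _ => (Set.finite_Iic k).image _).subset this

theorem POP.IsBipartite.hasRegularInsertionEncoding {k : ℕ} {P : POP k} (hP : P.IsBipartite) :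
    HasRegularInsertionEncoding (Av P) :=
  ⟨.of_finite_range_leftQuotient hP.range_leftQuotient.1, _, finite_setOf_slot_le k,
    fun _ hw _ hx => hP.slot_le hw hx⟩

/-! ### Non-bipartite POPs -/

/-- One letter removes at most one slot. -/
theorem count_le_of_evolve {v : ℕ} {c d : Configuration} {w : List InsertionLetter}
    (hd : evolve v c w = some d) (hn : none ∉ d) : c.count none ≤ w.length := by
  induction w generalizing v c with
  | nil =>
    obtain rfl : c = d := by simpa [evolve] using hd
    simp [List.count_eq_zero.2 hn]
  | cons x w ih =>
    obtain ⟨c', h₁, h₂⟩ := evolve_cons_eq_some.1 hd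
    have := ih h₂
    have := count_replaceSlot h₁
    simp only [List.length_cons]
    omega

theorem count_skeleton_alternating {v m : ℕ} {d : Configuration} (hl : d.length = 2 * m + 1)
    (h : ∀ i < 2 * m + 1, ∃ a, d[i]? = some (some a) ∧ (a < v ↔ i % 2 = 1)) :
    (skeleton v d).count none = m + 1 := by
  induction m generalizing d with
  | zero =>
    obtain ⟨x, rfl⟩ := List.length_eq_one_iff.1 hl
    obtain ⟨a, ha, ha'⟩ := h 0 (by omega)
    obtain rfl : x = some a := by simpa using ha
    have : ¬ a < v := by simpa using ha'
    simp [skeleton, this]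
  | succ m ih =>
    rcases d with _ | ⟨x, _ | ⟨y, d⟩⟩
    · simp at hl
    · simp at hl
    obtain ⟨a, ha, ha'⟩ := h 0 (by omega)
    obtain ⟨b, hb, hb'⟩ := h 1 (by omega)
    obtain rfl : x = some a := by simpa using ha
    obtain rfl : y = some b := by simpa using hb
    have h1 : ¬ a < v := by simpa using ha'
    have h2 : b < v := by simpa using hb'
    have := ih (d := d) (by simp at hl; omega) fun i hi => by
      simpa using h (i + 2) (by omega)
    simp [skeleton, h1, h2, this]

/-- The value at position `i` of the permutation of size `2 * m + 1` whose odd positions hold the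
values `< m`, increasingly if `p`, and whose even positions hold the other values, increasingly
if `q`. -/
def interleaveFun (p q : Prop) [Decidable p] [Decidable q] (m i : ℕ) : ℕ :=
  if i % 2 = 1 then (if p then i / 2 else m - 1 - i / 2) else (if q then m + i / 2 else 2 * m - i / 2)

theorem exists_interleave (p q : Prop) [Decidable p] [Decidable q] (m : ℕ) :
    ∃ π : Equiv.Perm (Fin (2 * m + 1)), ∀ i, (π i : ℕ) = interleaveFun p q m i := by
  have hlt : ∀ i < 2 * m + 1, interleaveFun p q m i < 2 * m + 1 := fun i hi => by
    unfold interleaveFun; split_ifs <;> omega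
  have hinj : Function.Injective fun i : Fin (2 * m + 1) =>
      (⟨interleaveFun p q m i, hlt i i.2⟩ : Fin (2 * m + 1)) := by
    intro i j h
    have h := Fin.mk.inj h
    have hi := i.2
    have hj := j.2
    ext
    unfold interleaveFun at h
    split_ifs at h <;> omega
  exact ⟨Equiv.ofBijective _ (Finite.injective_iff_bijective.1 hinj), fun i => rfl⟩

/-- The small block is monotone in the direction that forbids `a` and `b` both small, so `b` is
large; the large block forbids `b` and `c` both large, so `b` is small. -/
theorem exists_mem_av_alternating {k : ℕ} {P : POP k} {a b c : Fin k} (hab : P.lt a b)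
    (hbc : P.lt b c) (m : ℕ) : ∃ π : Equiv.Perm (Fin (2 * m + 1)), ¬ ContainsPOP π P ∧
      ∀ i, (π i : ℕ) < m ↔ (i : ℕ) % 2 = 1 := by
  obtain ⟨π, hπ⟩ := exists_interleave (b < a) (c < b) m
  refine ⟨π, ?_, fun i => ?_⟩
  · rintro ⟨i, hi, hlt⟩
    have h1 : (π (i a) : ℕ) < π (i b) := hlt a b hab
    have h2 : (π (i b) : ℕ) < π (i c) := hlt b c hbc
    have hne1 : a ≠ b := by rintro rfl; omega
    have hne2 : b ≠ c := by rintro rfl; omega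
    have e1 : (i b : ℕ) < i a ↔ b < a := hi.lt_iff_lt
    have e2 : (i a : ℕ) < i b ↔ a < b := hi.lt_iff_lt
    have e3 : (i c : ℕ) < i b ↔ c < b := hi.lt_iff_lt
    have e4 : (i b : ℕ) < i c ↔ b < c := hi.lt_iff_lt
    have ha := (i a).2
    have hb := (i b).2
    have hc := (i c).2
    rw [hπ, hπ] at h1 h2
    unfold interleaveFun at h1 h2
    rcases hne1.lt_or_gt with h3 | h3 <;> rcases hne2.lt_or_gt with h4 | h4 <;>
      simp only [h3, h4, h3.not_gt, h4.not_gt, if_true, if_false, iff_true, iff_false] at * <;>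
      split_ifs at h1 h2 <;> omega
  · rw [hπ]
    have := i.2
    unfold interleaveFun
    split_ifs <;> omega

/-- The quotient by `u m` contains a word of length `m + 1` but none shorter, since `m + 1` slots
are open; so these quotients are pairwise distinct. -/
theorem not_isRegular_of_lt_lt {k : ℕ} {P : POP k} {a b c : Fin k} (hab : P.lt a b)
    (hbc : P.lt b c) : ¬ (insertionEncoding (Av P)).IsRegular := by
  intro h
  have key : ∀ m : ℕ, ∃ u z : List InsertionLetter, z.length = m + 1 ∧
      Completes P 0 [none] (u ++ z) ∧
      ∀ e, evolve 0 [none] u = some e → e.count none = m + 1 := by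
    intro m
    obtain ⟨π, hπ, hm⟩ := exists_mem_av_alternating hab hbc m
    obtain ⟨w, hw⟩ := exists_encodes (by omega) π
    have hl := hw.length_eq
    -- After `m` letters exactly the small values are present, and each of the `m + 1` large ones
    -- lies in its own slot.
    refine ⟨w.take m, w.drop m, by simp; omega, ?_, fun e he => ?_⟩
    · rw [List.take_append_drop, ← mem_insertionEncoding_iff]
      exact ⟨⟨_, π⟩, hπ, hw⟩
    · rw [Encodes, ← List.take_append_drop m w, evolve_append, he, Option.bind_some] at hw
      have hlm : (w.take m).length = m := by simp; omega
      have hwf := (wellFormed_slot 0).evolve he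
      rw [hlm, zero_add] at hw hwf
      rw [← skeleton_evolve hwf hw]
      refine count_skeleton_alternating (by simp) fun i hi => ⟨π ⟨i, hi⟩, ?_, hm _⟩
      rw [List.getElem?_ofFn]
      simp [hi]
  choose u z hz hc he using key
  obtain ⟨i, j, hij, heq⟩ : ∃ i j, i < j ∧ (insertionEncoding (Av P)).leftQuotient (u i) =
      (insertionEncoding (Av P)).leftQuotient (u j) := by
    have hfin := h.finite_range_leftQuotient
    obtain ⟨i, -, j, -, hne, h⟩ := Set.infinite_univ.exists_ne_map_eq_of_mapsTo
      (f := fun i => (insertionEncoding (Av P)).leftQuotient (u i)) (fun i _ => Set.mem_range_self (u i)) hfin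
    rcases hne.lt_or_gt with h' | h'
    exacts [⟨i, j, h', h⟩, ⟨j, i, h', h.symm⟩]
  have hmem : z i ∈ (insertionEncoding (Av P)).leftQuotient (u j) := by
    rw [← heq, Language.mem_leftQuotient, mem_insertionEncoding_iff]
    exact hc i
  rw [Language.mem_leftQuotient, mem_insertionEncoding_iff, completes_append_iff] at hmem
  obtain ⟨e, he', d, hd, hn, -⟩ := hmem
  have := count_le_of_evolve hd hn
  rw [he j e he', hz] at this
  omega

theorem hasRegularInsertionEncoding_av_iff {k : ℕ} (P : POP k) :
    HasRegularInsertionEncoding (Av P) ↔ P.IsBipartite := by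
  refine ⟨fun h => isBipartite_iff.2 fun a b c hab hbc => ?_,
    POP.IsBipartite.hasRegularInsertionEncoding⟩
  exact not_isRegular_of_lt_lt hab hbc h.1

/-! ### Counting the words of a regular language -/

/-- The words of length `n` over the alphabet `A` that are accepted from the state `s`. -/
def acceptedWords {α σ : Type*} [DecidableEq α] (M : DFA α σ) [DecidablePred (· ∈ M.accept)]
    (A : Finset α) : ℕ → σ → Finset (List α)
  | 0, s => if s ∈ M.accept then {[]} else ∅
  | n + 1, s => A.biUnion fun x =>
      (acceptedWords M A n (M.step s x)).map ⟨List.cons x, List.cons_injective⟩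

theorem mem_acceptedWords {α σ : Type*} [DecidableEq α] {M : DFA α σ}
    [DecidablePred (· ∈ M.accept)] {A : Finset α} {n : ℕ} {s : σ} {w : List α} :
    w ∈ acceptedWords M A n s ↔ w.length = n ∧ (∀ x ∈ w, x ∈ A) ∧ w ∈ M.acceptsFrom s := by
  induction n generalizing s w with
  | zero =>
    rw [List.length_eq_zero_iff, acceptedWords]
    split_ifs with h
    · simp only [Finset.mem_singleton]
      exact ⟨fun hw => by subst hw; simpa [DFA.mem_acceptsFrom] using h, fun hw => hw.1⟩
    · simp only [Finset.notMem_empty, false_iff]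
      rintro ⟨rfl, -, h'⟩
      exact h (by simpa [DFA.mem_acceptsFrom] using h')
  | succ n ih =>
    simp only [acceptedWords, Finset.mem_biUnion, Finset.mem_map, Function.Embedding.coeFn_mk, ih]
    constructor
    · rintro ⟨x, hx, w, ⟨h1, h2, h3⟩, rfl⟩
      exact ⟨by simp [h1], by simpa [hx] using h2, by simpa [DFA.mem_acceptsFrom] using h3⟩
    · rintro ⟨h1, h2, h3⟩
      rcases w with _ | ⟨x, w⟩
      · simp at h1
      · refine ⟨x, h2 x (by simp), w, ⟨by simpa using h1, fun y hy => h2 y (by simp [hy]), ?_⟩, rfl⟩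
        simpa [DFA.mem_acceptsFrom] using h3

theorem card_acceptedWords_succ {α σ : Type*} [DecidableEq α] (M : DFA α σ)
    [DecidablePred (· ∈ M.accept)] (A : Finset α) (n : ℕ) (s : σ) :
    (acceptedWords M A (n + 1) s).card = ∑ x ∈ A, (acceptedWords M A n (M.step s x)).card := by
  rw [acceptedWords, Finset.card_biUnion]
  · simp
  · intro x _ y _ hxy
    rw [Function.onFun, Finset.disjoint_left]
    intro w hw hw'
    simp only [Finset.mem_map, Function.Embedding.coeFn_mk] at hw hw'
    obtain ⟨u, -, rfl⟩ := hw
    obtain ⟨u', -, h⟩ := hw'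
    exact hxy (List.cons.inj h).1.symm

/-- The reversed characteristic polynomial is the denominator: from degree `d` on, the coefficients
of the product are `φ (χ(T) (T ^ m v)) = 0` by Cayley–Hamilton. -/
theorem exists_recurrence {V : Type*} [AddCommGroup V] [Module.Free ℤ V] [Module.Finite ℤ V]
    (T : V →ₗ[ℤ] V) (φ : V →ₗ[ℤ] ℤ) (v : V) : ∃ q : Polynomial ℤ, q.coeff 0 = 1 ∧
      q.natDegree ≤ Module.finrank ℤ V ∧ ∀ n, Module.finrank ℤ V ≤ n →
        PowerSeries.coeff n ((q : PowerSeries ℤ) * PowerSeries.mk fun i => φ ((T ^ i) v)) = 0 := by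
  set d := Module.finrank ℤ V with hd
  have hdeg : T.charpoly.natDegree = d := T.charpoly_natDegree
  refine ⟨T.charpoly.reverse, ?_, (Polynomial.reverse_natDegree_le _).trans hdeg.le, ?_⟩
  · rw [Polynomial.coeff_zero_reverse, T.charpoly_monic.leadingCoeff]
  · intro n hn
    obtain ⟨m, rfl⟩ := Nat.exists_eq_add_of_le hn
    rw [PowerSeries.coeff_mul, Finset.Nat.sum_antidiagonal_eq_sum_range_succ_mk]
    have hsub : Finset.range (d + 1) ⊆ Finset.range (d + m).succ := by
      intro i hi
      simp only [Finset.mem_range] at hi ⊢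
      omega
    rw [← Finset.sum_subset hsub]
    · rw [← Finset.sum_range_reflect]
      have h0 := congrArg (fun S => φ (S ((T ^ m) v))) T.aeval_self_charpoly
      simp only [Polynomial.aeval_eq_sum_range, hdeg, LinearMap.sum_apply, LinearMap.smul_apply,
        map_sum, LinearMap.zero_apply, map_zero, map_smul, smul_eq_mul] at h0
      rw [← h0]
      refine Finset.sum_congr rfl fun i hi => ?_
      have hi := Finset.mem_range.1 hi
      have h1 : d + 1 - 1 - i = d - i := by omega
      have h2 : d + m - (d - i) = i + m := by omega
      rw [h1, h2, Polynomial.coeff_coe, PowerSeries.coeff_mk, Polynomial.coeff_reverse, hdeg,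
        Polynomial.revAt_le (by omega), pow_add, Module.End.mul_apply]
      congr 2
      omega
    · intro i _ hi
      have hi : d < i := by simpa using hi
      rw [Polynomial.coeff_coe, Polynomial.coeff_eq_zero_of_natDegree_lt, zero_mul]
      exact ((Polynomial.reverse_natDegree_le _).trans hdeg.le).trans_lt hi

/-- The operator `T` on functions on the states sums over the letters; its powers turn the indicator
of acceptance into the counts of accepted words. -/
theorem Language.exists_quotient {α : Type*} {L : Language α}
    (hL : (Set.range L.leftQuotient).Finite) {A : Set α} (hA : A.Finite)
    (hLA : ∀ w ∈ L, ∀ x ∈ w, x ∈ A) : ∃ q : Polynomial ℤ, q.coeff 0 = 1 ∧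
      q.natDegree ≤ (Set.range L.leftQuotient).ncard ∧
      ∀ n, (Set.range L.leftQuotient).ncard ≤ n → PowerSeries.coeff n ((q : PowerSeries ℤ) *
        PowerSeries.mk fun i => (Nat.card {w : List α // w ∈ L ∧ w.length = i} : ℤ)) = 0 := by
  classical
  have := hL.fintype
  let S := Set.range L.leftQuotient
  let T : (S → ℤ) →ₗ[ℤ] (S → ℤ) :=
    ∑ x ∈ hA.toFinset, LinearMap.funLeft ℤ ℤ fun s => L.toDFA.step s x
  have hT : ∀ n, (T ^ n) (fun s => ((acceptedWords L.toDFA hA.toFinset 0 s).card : ℤ)) =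
      fun s => ((acceptedWords L.toDFA hA.toFinset n s).card : ℤ) := by
    intro n
    induction n with
    | zero => rfl
    | succ n ih =>
      rw [pow_succ', Module.End.mul_apply, ih]
      ext s
      simp [T, card_acceptedWords_succ, LinearMap.funLeft_apply]
  have hcard : ∀ n, Nat.card {w : List α // w ∈ L ∧ w.length = n} =
      (acceptedWords L.toDFA hA.toFinset n L.toDFA.start).card := by
    intro n
    rw [← Nat.card_eq_finsetCard]
    refine Nat.card_congr (Equiv.subtypeEquivRight fun w => ?_)
    rw [mem_acceptedWords]
    have : w ∈ L.toDFA.acceptsFrom L.toDFA.start ↔ w ∈ L := by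
      conv_rhs => rw [← Language.accepts_toDFA L]
      rfl
    rw [this]
    simp only [Set.Finite.mem_toFinset]
    exact ⟨fun h => ⟨h.2, hLA w h.1, h.1⟩, fun h => ⟨h.2.2, h.1⟩⟩
  have hrank : Module.finrank ℤ (S → ℤ) = S.ncard := by
    rw [Module.finrank_fintype_fun_eq_card, ← Nat.card_eq_fintype_card, Nat.card_coe_set_eq]
  obtain ⟨q, h0, h1, h2⟩ := exists_recurrence T (LinearMap.proj L.toDFA.start)
    (fun s => ((acceptedWords L.toDFA hA.toFinset 0 s).card : ℤ))
  rw [hrank] at h1 h2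
  simp only [hT, LinearMap.proj_apply] at h2
  simp only [hcard]
  exact ⟨q, h0, h1, h2⟩

/-! ### The generating function -/

theorem card_insertionEncoding (C : Set (Σ n : ℕ, Equiv.Perm (Fin n))) {n : ℕ} (hn : 0 < n) :
    Nat.card {w : List InsertionLetter // w ∈ insertionEncoding C ∧ w.length = n} =
      Nat.card {π : Equiv.Perm (Fin n) // (⟨n, π⟩ : Σ m : ℕ, Equiv.Perm (Fin m)) ∈ C} := by
  choose e he using fun π : Equiv.Perm (Fin n) => exists_encodes hn π
  refine (Nat.card_eq_of_bijective (f := fun π : {π : Equiv.Perm (Fin n) //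
    (⟨n, π⟩ : Σ m : ℕ, Equiv.Perm (Fin m)) ∈ C} => (⟨e π, ⟨⟨⟨n, π⟩, π.2, he π⟩,
      (he π).length_eq⟩⟩ : {w // w ∈ insertionEncoding C ∧ w.length = n})) ⟨?_, ?_⟩).symm
  · intro π π' h
    have h : e π = e π' := congrArg Subtype.val h
    exact Subtype.ext ((he π).perm_unique (h ▸ he π'))
  · rintro ⟨w, ⟨⟨m, π⟩, hπ, hw⟩, hl⟩
    obtain rfl : m = n := hw.length_eq.symm.trans hl
    exact ⟨⟨π, hπ⟩, Subtype.ext ((he π).unique hw)⟩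

theorem POP.IsBipartite.exists_isQuotient {k : ℕ} {P : POP k} (hP : P.IsBipartite) :
    ∃ p q : Polynomial ℤ, IsQuotient (genFun (Av P)) p q ∧ p.natDegree ≤ stateBound k ∧
      q.natDegree ≤ stateBound k := by
  obtain ⟨q, h0, h1, h2⟩ := Language.exists_quotient hP.range_leftQuotient.1
    (finite_setOf_slot_le k) fun _ hw _ hx => hP.slot_le hw hx
  set d := (Set.range (insertionEncoding (Av P)).leftQuotient).ncard
  have hd : d ≤ stateBound k := hP.range_leftQuotient.2
  set f := PowerSeries.mk fun i =>
    (Nat.card {w : List InsertionLetter // w ∈ insertionEncoding (Av P) ∧ w.length = i} : ℤ)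
  -- Only the constant terms can differ: the empty permutation has no encoding.
  obtain ⟨a, ha⟩ : ∃ a : ℤ, genFun (Av P) = f + PowerSeries.C a := by
    refine ⟨PowerSeries.coeff 0 (genFun (Av P)) - PowerSeries.coeff 0 f, ?_⟩
    ext n
    rcases Nat.eq_zero_or_pos n with rfl | hn
    · simp
    · rw [map_add, PowerSeries.coeff_C, if_neg hn.ne', add_zero]
      simp [genFun, f, card_insertionEncoding _ hn]
  -- The correction `q * C a` may reach degree `d`, so the numerator is cut at `d + 1` rather than
  -- `d`.
  refine ⟨PowerSeries.trunc (d + 1) ((q : PowerSeries ℤ) * genFun (Av P)), q, ⟨by simp [h0], ?_⟩,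
    ?_, h1.trans hd⟩
  · ext n
    rw [Polynomial.coeff_coe, PowerSeries.coeff_trunc]
    split_ifs with hn
    · rfl
    · rw [ha, mul_add, map_add, h2 n (by omega), PowerSeries.coeff_mul_C, Polynomial.coeff_coe,
        Polynomial.coeff_eq_zero_of_natDegree_lt (by omega)]
      simp
  · exact (Nat.lt_succ_iff.1 (PowerSeries.natDegree_trunc_lt _ d)).trans hd

/-! ### Primitive recursive enumeration of the avoiders -/

theorem PrimrecPred.forall_lt_apply {α : Type*} [Primcodable α] {f : α → ℕ} {R : α × ℕ → Prop}
    (hR : PrimrecPred R) (hf : Primrec f) : PrimrecPred fun a => ∀ x < f a, R (a, x) :=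
  ((PrimrecRel.forall_mem_list (R := fun (x : ℕ) (a : α) => R (a, x))
    (hR.comp (Primrec.snd.pair Primrec.fst))).comp (Primrec.list_range.comp hf)
      Primrec.id).of_eq fun a => by simp

theorem PrimrecPred.exists_mem_apply {α β : Type*} [Primcodable α] [Primcodable β]
    {f : α → List β} {R : α × β → Prop} (hR : PrimrecPred R) (hf : Primrec f) :
    PrimrecPred fun a => ∃ x ∈ f a, R (a, x) :=
  (PrimrecRel.exists_mem_list (R := fun (x : β) (a : α) => R (a, x))
    (hR.comp (Primrec.snd.pair Primrec.fst))).comp hf Primrec.id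

/-- The lists of length `m` with entries `< n`. -/
def tuples (n : ℕ) : ℕ → List (List ℕ)
  | 0 => [[]]
  | m + 1 => (List.range n).flatMap fun a => (tuples n m).map (a :: ·)

theorem mem_tuples {n m : ℕ} {l : List ℕ} :
    l ∈ tuples n m ↔ l.length = m ∧ ∀ a ∈ l, a < n := by
  induction m generalizing l with
  | zero =>
    simp only [tuples, List.mem_singleton, List.length_eq_zero_iff]
    exact ⟨fun h => by simp [h], fun h => h.1⟩
  | succ m ih =>
    rcases l with _ | ⟨a, l⟩
    · simp [tuples]
    · simp only [tuples, List.mem_flatMap, List.mem_range, List.mem_map, ih, List.cons.injEq,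
        List.length_cons, List.mem_cons, forall_eq_or_imp, add_left_inj]
      constructor
      · rintro ⟨_, h, _, h', rfl, rfl⟩
        exact ⟨h'.1, h, h'.2⟩
      · rintro ⟨h₁, h, h₂⟩
        exact ⟨a, h, l, ⟨h₁, h₂⟩, rfl, rfl⟩

theorem nodup_tuples (n m : ℕ) : (tuples n m).Nodup := by
  induction m with
  | zero => simp [tuples]
  | succ m ih =>
    rw [tuples, List.nodup_flatMap]
    refine ⟨fun a _ => ih.map List.cons_injective, ?_⟩
    refine List.nodup_range.imp fun {a b} hab l hl hl' => ?_
    simp only [List.mem_map] at hl hl'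
    obtain ⟨_, -, rfl⟩ := hl
    obtain ⟨_, -, h⟩ := hl'
    exact hab (List.cons.inj h).1.symm

theorem primrec_tuples : Primrec₂ tuples := by
  have hg : Primrec₂ fun (n : ℕ) (p : ℕ × List (List ℕ)) =>
      (List.range n).flatMap fun a => p.2.map (a :: ·) := by
    refine Primrec.list_flatMap (Primrec.list_range.comp Primrec.fst) ?_
    exact Primrec.list_map (Primrec.snd.comp (Primrec.snd.comp Primrec.fst))
      (Primrec.list_cons.comp (Primrec.snd.comp Primrec.fst) Primrec.snd)
  refine (Primrec.nat_rec (Primrec.const [[]]) hg).of_eq fun n m => ?_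
  induction m with
  | zero => rfl
  | succ m ih =>
    exact congrArg
      (fun t : List (List ℕ) => (List.range n).flatMap fun a => t.map (a :: ·)) ih

/-- The positions listed by `i` form an occurrence in the list `l` of the pattern of size `k`
whose relations are listed by `E`. -/
def OccursAt (k : ℕ) (E : List (ℕ × ℕ)) (l i : List ℕ) : Prop :=
  ∀ a < k, ∀ b < k, (a < b → i.getD a 0 < i.getD b 0) ∧
    ((a, b) ∈ E → l.getD (i.getD a 0) 0 < l.getD (i.getD b 0) 0)

/-- The list `l` contains all numbers `< n`, and avoids the pattern given by `k` and `E`. -/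
def IsAvoider (k : ℕ) (E : List (ℕ × ℕ)) (n : ℕ) (l : List ℕ) : Prop :=
  (∀ j < n, ∃ x ∈ l, x = j) ∧ ¬ ∃ i ∈ tuples n k, OccursAt k E l i

open Classical in
/-- The number of permutations of size `n` avoiding the pattern given by `k` and `E`. -/
noncomputable def countAvoiders (k : ℕ) (E : List (ℕ × ℕ)) (n : ℕ) : ℕ :=
  ((tuples n n).filter fun l => IsAvoider k E n l).length

theorem primrecPred_occursAt : PrimrecPred
    fun p : (ℕ × List (ℕ × ℕ)) × List ℕ × List ℕ => OccursAt p.1.1 p.1.2 p.2.1 p.2.2 := by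
  have hk : Primrec fun p : (ℕ × List (ℕ × ℕ)) × List ℕ × List ℕ => p.1.1 :=
    Primrec.fst.comp Primrec.fst
  have hbody : PrimrecPred fun q : (((ℕ × List (ℕ × ℕ)) × List ℕ × List ℕ) × ℕ) × ℕ =>
      (q.1.2 < q.2 → q.1.1.2.2.getD q.1.2 0 < q.1.1.2.2.getD q.2 0) ∧
        ((q.1.2, q.2) ∈ q.1.1.1.2 → q.1.1.2.1.getD (q.1.1.2.2.getD q.1.2 0) 0 <
          q.1.1.2.1.getD (q.1.1.2.2.getD q.2 0) 0) := by
    have hb : Primrec fun q : (((ℕ × List (ℕ × ℕ)) × List ℕ × List ℕ) × ℕ) × ℕ => q.2 :=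
      Primrec.snd
    have ha : Primrec fun q : (((ℕ × List (ℕ × ℕ)) × List ℕ × List ℕ) × ℕ) × ℕ => q.1.2 :=
      Primrec.snd.comp Primrec.fst
    have hp : Primrec fun q : (((ℕ × List (ℕ × ℕ)) × List ℕ × List ℕ) × ℕ) × ℕ => q.1.1 :=
      Primrec.fst.comp Primrec.fst
    have hE : Primrec fun q : (((ℕ × List (ℕ × ℕ)) × List ℕ × List ℕ) × ℕ) × ℕ => q.1.1.1.2 :=
      (Primrec.snd.comp Primrec.fst).comp hp
    have hl : Primrec fun q : (((ℕ × List (ℕ × ℕ)) × List ℕ × List ℕ) × ℕ) × ℕ => q.1.1.2.1 :=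
      (Primrec.fst.comp Primrec.snd).comp hp
    have hi : Primrec fun q : (((ℕ × List (ℕ × ℕ)) × List ℕ × List ℕ) × ℕ) × ℕ => q.1.1.2.2 :=
      (Primrec.snd.comp Primrec.snd).comp hp
    have hia := (Primrec.list_getD 0).comp hi ha
    have hib := (Primrec.list_getD 0).comp hi hb
    have hmem : PrimrecPred fun q : (((ℕ × List (ℕ × ℕ)) × List ℕ × List ℕ) × ℕ) × ℕ =>
        (q.1.2, q.2) ∈ q.1.1.1.2 :=
      (PrimrecPred.exists_mem_apply (f := fun q : (((ℕ × List (ℕ × ℕ)) × List ℕ × List ℕ) × ℕ) × ℕ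
        => q.1.1.1.2) (R := fun r => r.2 = (r.1.1.2, r.1.2))
        (Primrec.eq.comp Primrec.snd ((ha.comp Primrec.fst).pair (hb.comp Primrec.fst))) hE).of_eq
        fun q => by simp
    refine PrimrecPred.and ?_ ?_
    · exact ((Primrec.nat_lt.comp ha hb).not.or (Primrec.nat_lt.comp hia hib)).of_eq
        fun q => imp_iff_not_or.symm
    · exact (hmem.not.or (Primrec.nat_lt.comp ((Primrec.list_getD 0).comp hl hia)
        ((Primrec.list_getD 0).comp hl hib))).of_eq fun q => imp_iff_not_or.symm
  exact (hbody.forall_lt_apply (hk.comp Primrec.fst)).forall_lt_apply hk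

theorem primrecPred_isAvoider : PrimrecPred
    fun p : ((ℕ × List (ℕ × ℕ)) × ℕ) × List ℕ => IsAvoider p.1.1.1 p.1.1.2 p.1.2 p.2 := by
  have hn : Primrec fun p : ((ℕ × List (ℕ × ℕ)) × ℕ) × List ℕ => p.1.2 :=
    Primrec.snd.comp Primrec.fst
  have hkE : Primrec fun p : ((ℕ × List (ℕ × ℕ)) × ℕ) × List ℕ => p.1.1 :=
    Primrec.fst.comp Primrec.fst
  have h1 : PrimrecPred fun q : (((ℕ × List (ℕ × ℕ)) × ℕ) × List ℕ) × ℕ =>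
      ∃ x ∈ q.1.2, x = q.2 :=
    PrimrecPred.exists_mem_apply
      (f := fun q : (((ℕ × List (ℕ × ℕ)) × ℕ) × List ℕ) × ℕ => q.1.2) (R := fun r => r.2 = r.1.2)
      (Primrec.eq.comp Primrec.snd (Primrec.snd.comp Primrec.fst)) (Primrec.snd.comp Primrec.fst)
  have h2 : PrimrecPred fun q : (((ℕ × List (ℕ × ℕ)) × ℕ) × List ℕ) × List ℕ =>
      OccursAt q.1.1.1.1 q.1.1.1.2 q.1.2 q.2 :=
    primrecPred_occursAt.comp ((hkE.comp Primrec.fst).pair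
      ((Primrec.snd.comp Primrec.fst).pair Primrec.snd))
  exact (h1.forall_lt_apply hn).and
    (h2.exists_mem_apply (primrec_tuples.comp hn (Primrec.fst.comp hkE))).not

theorem primrec_countAvoiders :
    Primrec₂ fun (p : ℕ × List (ℕ × ℕ)) (n : ℕ) => countAvoiders p.1 p.2 n := by
  classical
  have h : PrimrecRel fun (l : List ℕ) (p : (ℕ × List (ℕ × ℕ)) × ℕ) =>
      IsAvoider p.1.1 p.1.2 p.2 l :=
    primrecPred_isAvoider.comp (Primrec.snd.pair Primrec.fst)
  have h' := Primrec.list_length.comp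
    (h.listFilter.comp (primrec_tuples.comp Primrec.snd Primrec.snd) Primrec.id)
  refine h'.of_eq fun p => ?_
  simp only [countAvoiders, id]

theorem occursAt_iff {n k : ℕ} {P : POP k} {E : List (ℕ × ℕ)} (hE : P.IsDescribedBy E)
    (π : Equiv.Perm (Fin n)) :
    (∃ i ∈ tuples n k, OccursAt k E (List.ofFn fun j => (π j : ℕ)) i) ↔ ContainsPOP π P := by
  have hget : ∀ j (hj : j < n), (List.ofFn fun j => (π j : ℕ)).getD j 0 = π ⟨j, hj⟩ := fun j hj => by
    simp [List.getD_eq_getElem?_getD, hj]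
  constructor
  · rintro ⟨i, hi, h⟩
    obtain ⟨hl, hlt⟩ := mem_tuples.1 hi
    have hlt' : ∀ a : Fin k, i.getD a 0 < n := fun a => by
      rw [List.getD_eq_getElem _ _ (by omega)]
      exact hlt _ (List.getElem_mem _)
    refine ⟨fun a => ⟨i.getD a 0, hlt' a⟩, fun a b hab => (h a a.2 b b.2).1 hab, fun a b hab => ?_⟩
    have := (h a a.2 b b.2).2 ((hE a b).1 hab)
    rw [hget _ (hlt' a), hget _ (hlt' b)] at this
    exact this
  · rintro ⟨i, hi, h⟩
    have hi' : ∀ a (ha : a < k), (List.ofFn fun a => (i a : ℕ)).getD a 0 = i ⟨a, ha⟩ :=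
      fun a ha => by simp [List.getD_eq_getElem?_getD, ha]
    refine ⟨List.ofFn fun a => (i a : ℕ), mem_tuples.2 ⟨by simp, ?_⟩, fun a ha b hb => ?_⟩
    · simp
    · rw [hi' a ha, hi' b hb, hget _ (i _).2, hget _ (i _).2]
      exact ⟨fun hab => hi (show (⟨a, ha⟩ : Fin k) < ⟨b, hb⟩ from hab),
        fun hab => h _ _ ((hE ⟨a, ha⟩ ⟨b, hb⟩).2 hab)⟩

/-- A list of length `n` with entries `< n` that contains all of them is the word of a unique
permutation. -/
theorem coeff_genFun_av {k : ℕ} {P : POP k} {E : List (ℕ × ℕ)} (hE : P.IsDescribedBy E) (n : ℕ) :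
    PowerSeries.coeff n (genFun (Av P)) = countAvoiders k E n := by
  classical
  have hmem : ∀ l : List ℕ, l ∈ ((tuples n n).filter fun l => IsAvoider k E n l).toFinset ↔
      l ∈ tuples n n ∧ IsAvoider k E n l := fun l => by simp
  have h1 : countAvoiders k E n =
      ((tuples n n).filter fun l => IsAvoider k E n l).toFinset.card := by
    rw [List.toFinset_card_of_nodup ((nodup_tuples n n).filter _), countAvoiders]
  rw [genFun, PowerSeries.coeff_mk, h1, ← Nat.card_eq_finsetCard]
  have hav : ∀ π : Equiv.Perm (Fin n), (⟨n, π⟩ : Σ m : ℕ, Equiv.Perm (Fin m)) ∈ Av P ↔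
      ¬ ∃ i ∈ tuples n k, OccursAt k E (List.ofFn fun j => (π j : ℕ)) i := fun π => by
    rw [occursAt_iff hE]; rfl
  congr 1
  refine Nat.card_eq_of_bijective (fun π => ⟨List.ofFn fun j => (π.1 j : ℕ), (hmem _).2
    ⟨mem_tuples.2 ⟨by simp, by simp⟩, ?_, (hav π.1).1 π.2⟩⟩) ⟨?_, ?_⟩
  · intro j hj
    exact ⟨j, by rw [List.mem_ofFn]; exact ⟨π.1.symm ⟨j, hj⟩, by simp⟩, rfl⟩
  · intro π π' h
    have h := List.ofFn_injective (congrArg Subtype.val h)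
    ext j
    exact congrFun h j
  · rintro ⟨l, hl⟩
    obtain ⟨hl, hsurj, hocc⟩ := (hmem l).1 hl
    obtain ⟨hlen, hlt⟩ := mem_tuples.1 hl
    have hf : Function.Surjective fun j : Fin n =>
        (⟨l[j], hlt _ (List.getElem_mem _)⟩ : Fin n) := by
      rintro ⟨j, hj⟩
      obtain ⟨x, hx, rfl⟩ := hsurj j hj
      obtain ⟨i, hi, rfl⟩ := List.getElem_of_mem hx
      exact ⟨⟨i, by omega⟩, rfl⟩
    have hof : (List.ofFn fun j : Fin n =>
        ((Equiv.ofBijective _ (Finite.surjective_iff_bijective.1 hf) j : Fin n) : ℕ)) = l := by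
      apply List.ext_getElem
      · simp [hlen]
      · intro i h₁ h₂
        simp
    refine ⟨⟨Equiv.ofBijective _ (Finite.surjective_iff_bijective.1 hf), ?_⟩, Subtype.ext hof⟩
    rw [hav, hof]
    exact hocc

/-! ### Finding the generating function by search -/

theorem coeff_polyOfList (l : List ℤ) (i : ℕ) : (polyOfList l).coeff i = l.getD i 0 := by
  induction l generalizing i with
  | nil => simp [polyOfList]
  | cons a l ih =>
    rw [polyOfList, Polynomial.coeff_add, Polynomial.coeff_C]
    cases i <;> simp [ih]

theorem natDegree_polyOfList_le {l : List ℤ} {n : ℕ} (h : l.length ≤ n + 1) :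
    (polyOfList l).natDegree ≤ n := by
  rw [Polynomial.natDegree_le_iff_coeff_eq_zero]
  intro i hi
  rw [coeff_polyOfList, List.getD_eq_default _ _ (by omega)]

theorem exists_polyOfList {p : Polynomial ℤ} {n : ℕ} (h : p.natDegree ≤ n) :
    ∃ l : List ℤ, l.length ≤ n + 1 ∧ polyOfList l = p := by
  refine ⟨(List.range (n + 1)).map p.coeff, by simp, ?_⟩
  ext i
  rw [coeff_polyOfList, List.getD_eq_getElem?_getD, List.getElem?_map]
  rcases lt_or_ge i (n + 1) with hi | hi
  · simp [List.getElem?_range hi]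
  · rw [List.getElem?_eq_none (by simpa using hi)]
    exact (Polynomial.coeff_eq_zero_of_natDegree_lt (by omega)).symm

/-- A rational function of degree at most `n` is determined by its first coefficients. -/
theorem IsQuotient.of_coeff_eq {f : PowerSeries ℤ} {p q p' q' : Polynomial ℤ} {n : ℕ}
    (h : IsQuotient f p q) (hp : p.natDegree ≤ n) (hq : q.natDegree ≤ n) (hp' : p'.natDegree ≤ n)
    (hq' : q'.natDegree ≤ n) (h0 : q'.coeff 0 ≠ 0)
    (hf : ∀ m < 2 * n + 1, PowerSeries.coeff m ((q' : PowerSeries ℤ) * f) = p'.coeff m) :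
    IsQuotient f p' q' := by
  refine ⟨h0, ?_⟩
  have hq0 : (q : PowerSeries ℤ) ≠ 0 := fun h' => h.1 (by
    rw [← Polynomial.coeff_coe, h']; simp)
  -- The polynomial has degree at most `2 * n` and equals `q * (q' * f - p')`, which vanishes in all
  -- degrees below `2 * n + 1`.
  have key : q' * p - q * p' = 0 := by
    ext m
    rcases lt_or_ge m (2 * n + 1) with hm | hm
    · have hcoe : ((q' * p - q * p' : Polynomial ℤ) : PowerSeries ℤ) =
          (q : PowerSeries ℤ) * ((q' : PowerSeries ℤ) * f - p') := by
        have h1 : ((q' * p - q * p' : Polynomial ℤ) : PowerSeries ℤ) =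
            (q' : PowerSeries ℤ) * p - q * p' := by
          rw [← Polynomial.coe_mul, ← Polynomial.coe_mul, ← Polynomial.coe_sub]
        rw [h1, ← h.2]
        ring
      rw [← Polynomial.coeff_coe, hcoe, PowerSeries.coeff_mul, Polynomial.coeff_zero]
      refine Finset.sum_eq_zero fun x hx => ?_
      have hx : x.1 + x.2 = m := Finset.HasAntidiagonal.mem_antidiagonal.1 hx
      rw [map_sub, hf x.2 (by omega), Polynomial.coeff_coe p', sub_self, mul_zero]
    · rw [Polynomial.coeff_zero]
      refine Polynomial.coeff_eq_zero_of_natDegree_lt (lt_of_le_of_lt ?_ hm)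
      refine (Polynomial.natDegree_sub_le _ _).trans (max_le ?_ ?_) <;>
        refine Polynomial.natDegree_mul_le.trans ?_ <;> omega
  apply mul_left_cancel₀ hq0
  have h1 : (q' : PowerSeries ℤ) * p = q * p' := by
    rw [← Polynomial.coe_mul, ← Polynomial.coe_mul, sub_eq_zero.1 key]
  rw [← h1, ← h.2]
  ring

theorem sum_map_range (f : ℕ → ℕ) (n : ℕ) :
    ((List.range n).map f).sum = ∑ i ∈ Finset.range n, f i := by
  induction n with
  | zero => rfl
  | succ n ih => simp [List.range_succ, Finset.sum_range_succ, ih]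

theorem primrec_list_sum : Primrec (List.sum : List ℕ → ℕ) :=
  (Primrec.list_foldr Primrec.id (Primrec.const 0) (h := fun _ p => p.1 + p.2)
    (Primrec.nat_add.comp (Primrec.fst.comp Primrec.snd) (Primrec.snd.comp Primrec.snd))).of_eq
    fun _ => rfl

theorem encode_int_ofNat (n : ℕ) : Encodable.encode (n : ℤ) = 2 * n := rfl

theorem encode_int_negSucc (n : ℕ) : Encodable.encode (Int.negSucc n) = 2 * n + 1 := rfl

/-- The code of an integer is even exactly when the integer is nonnegative, and half of it gives the
absolute value up to one. -/
theorem primrec_toNat : Primrec Int.toNat := by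
  have h : Primrec fun z : ℤ => Encodable.encode z := Primrec.encode
  refine (Primrec.ite (Primrec.eq.comp (Primrec.nat_mod.comp h (Primrec.const 2))
    (Primrec.const 0)) (Primrec.nat_div.comp h (Primrec.const 2)) (Primrec.const 0)).of_eq ?_
  rintro (n | n)
  · have := encode_int_ofNat n
    simp only [Int.ofNat_eq_natCast, this, Int.toNat_natCast]
    split_ifs <;> omega
  · have := encode_int_negSucc n
    rw [if_neg (by omega), Int.toNat_negSucc]

theorem primrec_toNat_neg : Primrec fun z : ℤ => (-z).toNat := by
  have h : Primrec fun z : ℤ => Encodable.encode z := Primrec.encode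
  refine (Primrec.ite (Primrec.eq.comp (Primrec.nat_mod.comp h (Primrec.const 2))
    (Primrec.const 0)) (Primrec.const 0) (Primrec.succ.comp
      (Primrec.nat_div.comp h (Primrec.const 2)))).of_eq ?_
  rintro (n | n)
  · have := encode_int_ofNat n
    simp only [Int.ofNat_eq_natCast, this]
    split_ifs <;> omega
  · have := encode_int_negSucc n
    rw [if_neg (by omega), Int.neg_negSucc]
    omega

/-- The sum `∑ i ≤ m, s (q i) * a (m - i)`, where `s` extracts the positive or the negative part of
the coefficients. -/
noncomputable def convolution (s : ℤ → ℕ) (k : ℕ) (E : List (ℕ × ℕ)) (q : List ℤ) (m : ℕ) : ℕ :=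
  ((List.range (m + 1)).map fun i => s (q.getD i 0) * countAvoiders k E (m - i)).sum

/-- The lists `r.1` and `r.2` have at most `N + 1` entries, where `N` is the bound for the degrees,
and agree with the generating function up to the coefficient of degree `2 * N`. -/
def IsCandidate (k : ℕ) (E : List (ℕ × ℕ)) (r : List ℤ × List ℤ) : Prop :=
  (r.1.length ≤ stateBound k + 1 ∧ r.2.length ≤ stateBound k + 1 ∧ r.2.getD 0 0 ≠ 0) ∧
    ∀ m < 2 * stateBound k + 1,
      convolution Int.toNat k E r.2 m + (-r.1.getD m 0).toNat =
        convolution (fun z => (-z).toNat) k E r.2 m + (r.1.getD m 0).toNat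

/-- Negative terms stand on the opposite side in `IsCandidate`, so that the test only adds and
multiplies natural numbers. -/
theorem isCandidate_iff {k : ℕ} {P : POP k} {E : List (ℕ × ℕ)} (hE : P.IsDescribedBy E)
    (r : List ℤ × List ℤ) : IsCandidate k E r ↔
      (r.1.length ≤ stateBound k + 1 ∧ r.2.length ≤ stateBound k + 1 ∧
        (polyOfList r.2).coeff 0 ≠ 0) ∧ ∀ m < 2 * stateBound k + 1,
      PowerSeries.coeff m ((polyOfList r.2 : PowerSeries ℤ) * genFun (Av P)) =
        (polyOfList r.1).coeff m := by
  have hsum : ∀ m, PowerSeries.coeff m ((polyOfList r.2 : PowerSeries ℤ) * genFun (Av P)) =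
      (convolution Int.toNat k E r.2 m : ℤ) - convolution (fun z => (-z).toNat) k E r.2 m := by
    intro m
    rw [PowerSeries.coeff_mul, Finset.Nat.sum_antidiagonal_eq_sum_range_succ_mk]
    have hconv : ∀ s : ℤ → ℕ, (convolution s k E r.2 m : ℤ) = ∑ i ∈ Finset.range (m + 1),
        (s (r.2.getD i 0) : ℤ) * countAvoiders k E (m - i) := fun s => by
      rw [convolution, sum_map_range]
      push_cast
      rfl
    rw [hconv, hconv, ← Finset.sum_sub_distrib]
    refine Finset.sum_congr rfl fun i _ => ?_
    rw [Polynomial.coeff_coe, coeff_polyOfList, coeff_genFun_av hE, ← sub_mul,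
      Int.toNat_sub_toNat_neg]
  rw [IsCandidate, coeff_polyOfList]
  refine and_congr_right fun _ => forall₂_congr fun m _ => ?_
  rw [hsum, coeff_polyOfList]
  have := Int.toNat_sub_toNat_neg (r.1.getD m 0)
  omega

theorem primrec_stateBound : Primrec stateBound := by
  have hpow : Primrec₂ ((· ^ ·) : ℕ → ℕ → ℕ) := Primrec₂.unpaired'.1 Nat.Primrec.pow
  have h : Primrec fun k : ℕ => 2 * k + 2 :=
    Primrec.nat_add.comp (Primrec.nat_mul.comp (Primrec.const 2) Primrec.id) (Primrec.const 2)
  exact Primrec.succ.comp (Primrec.nat_mul.comp Primrec.succ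
    (hpow.comp (Primrec.const 2) (hpow.comp h Primrec.id)))

theorem primrec_convolution {s : ℤ → ℕ} (hs : Primrec s) :
    Primrec fun p : ((ℕ × List (ℕ × ℕ)) × List ℤ) × ℕ =>
      convolution s p.1.1.1 p.1.1.2 p.1.2 p.2 := by
  refine primrec_list_sum.comp (Primrec.list_map
    (Primrec.list_range.comp (Primrec.succ.comp Primrec.snd)) ?_)
  refine Primrec.nat_mul.comp (hs.comp ((Primrec.list_getD 0).comp
    (Primrec.snd.comp (Primrec.fst.comp Primrec.fst)) Primrec.snd)) ?_
  exact primrec_countAvoiders.comp (Primrec.fst.comp (Primrec.fst.comp Primrec.fst))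
    (Primrec.nat_sub.comp (Primrec.snd.comp Primrec.fst) Primrec.snd)

theorem primrecPred_isCandidate : PrimrecPred
    fun p : (ℕ × List (ℕ × ℕ)) × List ℤ × List ℤ => IsCandidate p.1.1 p.1.2 p.2 := by
  have hN : Primrec fun p : (ℕ × List (ℕ × ℕ)) × List ℤ × List ℤ => stateBound p.1.1 :=
    primrec_stateBound.comp (Primrec.fst.comp Primrec.fst)
  have hp : Primrec fun p : (ℕ × List (ℕ × ℕ)) × List ℤ × List ℤ => p.2.1 :=
    Primrec.fst.comp Primrec.snd
  have hq : Primrec fun p : (ℕ × List (ℕ × ℕ)) × List ℤ × List ℤ => p.2.2 :=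
    Primrec.snd.comp Primrec.snd
  refine PrimrecPred.and (PrimrecPred.and ?_ (PrimrecPred.and ?_ ?_)) ?_
  · exact Primrec.nat_le.comp (Primrec.list_length.comp hp) (Primrec.succ.comp hN)
  · exact Primrec.nat_le.comp (Primrec.list_length.comp hq) (Primrec.succ.comp hN)
  · exact (Primrec.eq.comp ((Primrec.list_getD 0).comp hq (Primrec.const 0))
      (Primrec.const 0)).not
  · have hconv : ∀ s : ℤ → ℕ, Primrec s →
        Primrec fun q : ((ℕ × List (ℕ × ℕ)) × List ℤ × List ℤ) × ℕ =>
          convolution s q.1.1.1 q.1.1.2 q.1.2.2 q.2 := fun s hs =>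
      (primrec_convolution hs).comp
        (((Primrec.fst.comp Primrec.fst).pair (hq.comp Primrec.fst)).pair Primrec.snd)
    have hget : Primrec fun q : ((ℕ × List (ℕ × ℕ)) × List ℤ × List ℤ) × ℕ =>
        q.1.2.1.getD q.2 0 := (Primrec.list_getD 0).comp (hp.comp Primrec.fst) Primrec.snd
    have hbody : PrimrecPred fun q : ((ℕ × List (ℕ × ℕ)) × List ℤ × List ℤ) × ℕ =>
        convolution Int.toNat q.1.1.1 q.1.1.2 q.1.2.2 q.2 + (-q.1.2.1.getD q.2 0).toNat =
          convolution (fun z => (-z).toNat) q.1.1.1 q.1.1.2 q.1.2.2 q.2 +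
            (q.1.2.1.getD q.2 0).toNat :=
      Primrec.eq.comp
        (Primrec.nat_add.comp (hconv _ primrec_toNat) (primrec_toNat_neg.comp hget))
        (Primrec.nat_add.comp (hconv _ primrec_toNat_neg) (primrec_toNat.comp hget))
    exact hbody.forall_lt_apply
      (Primrec.succ.comp (Primrec.nat_mul.comp (Primrec.const 2) hN))

open Classical in
/-- The search for a pair of polynomials that agrees with the generating function. -/
noncomputable def searchQuotient (a : ℕ × List (ℕ × ℕ)) : Part (List ℤ × List ℤ) :=
  Nat.rfindOpt fun n => (Encodable.decode (α := List ℤ × List ℤ) n).bind fun r =>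
    if IsCandidate a.1 a.2 r then some r else none

theorem partrec_searchQuotient : Partrec searchQuotient := by
  classical
  refine Partrec.rfindOpt (Primrec₂.to_comp ?_)
  refine Primrec.option_bind (Primrec.decode.comp Primrec.snd) ?_
  exact Primrec.ite (primrecPred_isCandidate.comp ((Primrec.fst.comp Primrec.fst).pair Primrec.snd))
    (Primrec.option_some.comp Primrec.snd) (Primrec.const none)

theorem exists_mem_searchQuotient {k : ℕ} {E : List (ℕ × ℕ)} (h : ∃ r, IsCandidate k E r) :
    ∃ r ∈ searchQuotient (k, E), IsCandidate k E r := by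
  classical
  obtain ⟨r, hr⟩ := h
  have hdom : (searchQuotient (k, E)).Dom := by
    refine Nat.rfindOpt_dom.2 ⟨Encodable.encode r, r, ?_⟩
    rw [Encodable.encodek, Option.bind_some, if_pos hr]
    rfl
  refine ⟨_, Part.get_mem hdom, ?_⟩
  obtain ⟨n, hn⟩ := Nat.rfindOpt_spec (Part.get_mem hdom)
  simp only [Option.mem_def, Option.bind_eq_some_iff] at hn
  obtain ⟨r', -, h'⟩ := hn
  split_ifs at h' with hc
  rw [← Option.some.inj h']
  exact hc

/-- The pair from `exists_isQuotient` makes the search halt. The pair found may be another one, but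
`IsQuotient.of_coeff_eq` makes every candidate correct. -/
theorem POP.IsBipartite.exists_mem_searchQuotient {k : ℕ} {P : POP k} (hP : P.IsBipartite)
    {E : List (ℕ × ℕ)} (hE : P.IsDescribedBy E) : ∃ r ∈ searchQuotient (k, E),
      IsQuotient (genFun (Av P)) (polyOfList r.1) (polyOfList r.2) := by
  obtain ⟨p, q, hpq, hp, hq⟩ := hP.exists_isQuotient
  obtain ⟨lp, hlp, rfl⟩ := exists_polyOfList hp
  obtain ⟨lq, hlq, rfl⟩ := exists_polyOfList hq
  obtain ⟨r, hr, hc⟩ := _root_.exists_mem_searchQuotient (k := k) (E := E)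
    ⟨(lp, lq), (isCandidate_iff hE _).2 ⟨⟨hlp, hlq, hpq.1⟩, fun m _ => by
      rw [hpq.2, Polynomial.coeff_coe]⟩⟩
  obtain ⟨⟨h1, h2, h3⟩, h4⟩ := (isCandidate_iff hE r).1 hc
  exact ⟨r, hr, hpq.of_coeff_eq hp hq (natDegree_polyOfList_le h1) (natDegree_polyOfList_le h2)
    h3 h4⟩

theorem theorem2 :
    -- a POP class has a regular insertion encoding iff its poset is bipartite
    (∀ (k : ℕ) (P : POP k), HasRegularInsertionEncoding (Av P) ↔ P.IsBipartite) ∧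
    -- every bipartite POP class has a rational generating function
    (∀ (k : ℕ) (P : POP k), P.IsBipartite →
      ∃ p q : Polynomial ℤ, IsQuotient (genFun (Av P)) p q) ∧
    -- one algorithm computes it from any bipartite poset
    (∃ F : ℕ × List (ℕ × ℕ) →. List ℤ × List ℤ, Partrec F ∧
      ∀ (k : ℕ) (P : POP k) (E : List (ℕ × ℕ)), P.IsDescribedBy E → P.IsBipartite →
        ∃ r ∈ F (k, E), IsQuotient (genFun (Av P)) (polyOfList r.1) (polyOfList r.2)) := by
  exact ⟨fun k P => hasRegularInsertionEncoding_av_iff P,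
    fun k P hP => let ⟨p, q, h, _⟩ := hP.exists_isQuotient; ⟨p, q, h⟩,
    searchQuotient, partrec_searchQuotient,
    fun k P E hE hP => hP.exists_mem_searchQuotient hE⟩
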